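/- **Setting.** Let $f(\theta,x)\in\mathbb R$ be the prediction of a model (e.g. a network of any architecture) with parameters $\theta\in\mathbb R^d$ at input $x$, and let $(x_1,y_1),\dots,(x_n,y_n)$, $y_i\in\mathbb R$, be training data. SGD under squared $\ell_2$ loss with label noise, learning rate $\eta>0$ and initial value $\theta(0)$ is the process $$\theta(t+1)=\theta(t)-\eta\,\nabla_\theta\Big[\big(f(\theta,x_{i_t})-(y_{i_t}+\xi_t)\big)^2\Big]_{\theta=\theta(t)},$$ where $i_0,i_1,\dots$ are uniform on $\{1,\dots,n\}$, the $\xi_t$ are real random variables with mean $0$ and variance $1$, bounded by a common constant, and all the $i_t,\xi_t$ are mutually independent. The implicit regularizer is $$\mathrm{reg}(\theta)=\frac1n\sum_{i=1}^n\|\nabla_\theta f(\theta,x_i)\|_2^2 .$$ **Definitions.** The point $\theta^*\in\mathbb R^d$ is *non-repellent* if there is $\kappa>0$ such that for all sufficiently small $\eta>0$ and every $\theta(0)$ with $\|\theta(0)-\theta^*\|\le\eta^{0.5}$, with probability at least $1-\exp(-\eta^{-\kappa})$, $$\|\theta(t)-\theta^*\|\le\eta^{0.44}\quad\text{for all integers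 } 0\le t\le\eta^{-1.6}.$$ It is *strongly repellent* if there are constants $c_1,c_2,\kappa>0$ such that for all sufficiently small $\eta>0$ and every $\theta(0)$ with $\|\theta(0)-\theta^*\|\le\eta^{0.5}$, with probability at least $1-\exp(-\eta^{-\kappa})$, at time $t=\lfloor\eta^{-1.6}\rfloor$ both $$\|\theta(t)-\theta^*\|\ge c_1\eta^{0.4}\qquad\text{and}\qquad \mathrm{reg}(\theta(0))-\mathrm{reg}(\theta(t))=c_2\,\eta^{0.4}+o(\eta^{0.4}),$$ where the $o(\eta^{0.4})$ is bounded by a function of $\eta$ alone that does not depend on $\theta(0)$ or on the randomness. ("Sufficiently small", the constants, and this function may depend on the model, the data, $\theta^*$ and the law of the noise.) **Theorem.** Suppose that $f(\theta^*,x_i)=y_i$ for all $i$ (zero training error) and that each $\theta\mapsto f(\theta,x_i)$ is three times continuously differentiable near $\theta^*$. Let $$V=\{v\in\mathbb R^d:\ \langle\nabla_\theta f(\theta^*,x_i),v\rangle=0\ \text{ for all } i\}.$$ If $\langle\nabla\,\mathrm{reg}(\theta^*),v\rangle=0$ for all $v\in V$, then $\theta^*$ is non-repellent. Otherwise, $\theta^*$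 is strongly repellent. -/

import Mathlib

open MeasureTheory ProbabilityTheory Filter Topology Asymptotics
open scoped ENNReal Gradient

noncomputable section

namespace LabelNoiseSGD

/-- The parameter space `ℝ^d` with its Euclidean norm. -/
abbrev Param (d : ℕ) : Type := EuclideanSpace ℝ (Fin d)

/-- The implicit regularizer: the average over the training inputs `x i` of the squared Euclidean
norm of the gradient, with respect to the parameters, of the prediction of the model `f`. -/
def reg {d n : ℕ} {X : Type*} (f : Param d → X → ℝ) (x : Fin n → X) (θ : Param d) : ℝ :=
  (1 / (n : ℝ)) * ∑ i, ‖∇ (fun ϑ => f ϑ (x i)) θ‖ ^ 2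

/-- The iterates of SGD with learning rate `η` for the squared loss, started at `θ₀`.
In step `t` the gradient is taken at the data point with index `idx t`, and the label
`y (idx t)` is perturbed by the noise `ξ t`. -/
def iterate {d n : ℕ} {X : Type*} (f : Param d → X → ℝ) (x : Fin n → X) (y : Fin n → ℝ)
    (η : ℝ) (θ₀ : Param d) (idx : ℕ → Fin n) (ξ : ℕ → ℝ) : ℕ → Param d
  | 0 => θ₀
  | t + 1 =>
      iterate f x y η θ₀ idx ξ t -
        η • ∇ (fun ϑ => (f ϑ (x (idx t)) - (y (idx t) + ξ t)) ^ 2) (iterate f x y η θ₀ idx ξ t)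

/-- The randomness of SGD with independent bounded label noise of unit variance: in each step a
data index, uniform on the `n` data points, and a centred label perturbation of variance one; all
of these are mutually independent, and the perturbations are bounded by one common constant. -/
structure IsSampling {n : ℕ} {Ω : Type*} [MeasurableSpace Ω] (P : Measure Ω)
    (idx : ℕ → Ω → Fin n) (ξ : ℕ → Ω → ℝ) : Prop where
  measurable_idx : ∀ t, Measurable (idx t)
  measurable_noise : ∀ t, Measurable (ξ t)
  uniform : ∀ t i, P (idx t ⁻¹' {i}) = (n : ℝ≥0∞)⁻¹
  bounded : ∃ B : ℝ, ∀ t, ∀ᵐ ω ∂P, |ξ t ω| ≤ B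
  mean_zero : ∀ t, ∫ ω, ξ t ω ∂P = 0
  unit_variance : ∀ t, variance (ξ t) P = 1
  indep_steps : iIndepFun (fun t ω => (idx t ω, ξ t ω)) P
  indep_idx_noise : ∀ t, IndepFun (idx t) (ξ t) P

/-- `θs` is non-repellent: for some `κ > 0` and all sufficiently small `η > 0`, whenever
`‖θ(0) - θs‖ ≤ η^0.5`, with probability at least `1 - exp (-η^(-κ))` all iterates up to time
`η^(-1.6)` satisfy `‖θ(t) - θs‖ ≤ η^0.44`. -/
def NonRepellent {d n : ℕ} {X Ω : Type*} [MeasurableSpace Ω] (f : Param d → X → ℝ)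
    (x : Fin n → X) (y : Fin n → ℝ) (P : Measure Ω) (idx : ℕ → Ω → Fin n) (ξ : ℕ → Ω → ℝ)
    (θs : Param d) : Prop :=
  ∃ κ : ℝ, 0 < κ ∧ ∀ᶠ η : ℝ in 𝓝[>] 0, ∀ θ₀ : Param d, ‖θ₀ - θs‖ ≤ η ^ (0.5 : ℝ) →
    P {ω | ∀ t : ℕ, (t : ℝ) ≤ η ^ (-1.6 : ℝ) →
        ‖iterate f x y η θ₀ (fun s => idx s ω) (fun s => ξ s ω) t - θs‖ ≤ η ^ (0.44 : ℝ)}ᶜ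
      ≤ ENNReal.ofReal (Real.exp (-(η ^ (-κ))))

/-- `θs` is strongly repellent: there are constants `c₁, c₂ > 0` such that for some `κ > 0` and all
sufficiently small `η > 0`, whenever `‖θ(0) - θs‖ ≤ η^0.5`, with probability at least
`1 - exp (-η^(-κ))`, at time `t = ⌊η^(-1.6)⌋` both `‖θ(t) - θs‖ ≥ c₁ η^0.4` and
`reg(θ(0)) - reg(θ(t)) = c₂ η^0.4 + o(η^0.4)`. The function `r` is the bound on the error term;
it does not depend on the starting point or on the randomness. -/
def StronglyRepellent {d n : ℕ} {X Ω : Type*} [MeasurableSpace Ω] (f : Param d → X → ℝ)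
    (x : Fin n → X) (y : Fin n → ℝ) (P : Measure Ω) (idx : ℕ → Ω → Fin n) (ξ : ℕ → Ω → ℝ)
    (θs : Param d) : Prop :=
  ∃ c₁ c₂ κ : ℝ, 0 < c₁ ∧ 0 < c₂ ∧ 0 < κ ∧
  ∃ r : ℝ → ℝ, (r =o[𝓝[>] 0] fun η : ℝ => η ^ (0.4 : ℝ)) ∧
    ∀ᶠ η : ℝ in 𝓝[>] 0, ∀ θ₀ : Param d, ‖θ₀ - θs‖ ≤ η ^ (0.5 : ℝ) →
      P {ω |
          c₁ * η ^ (0.4 : ℝ) ≤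
            ‖iterate f x y η θ₀ (fun s => idx s ω) (fun s => ξ s ω) ⌊η ^ (-1.6 : ℝ)⌋₊ - θs‖ ∧
          |reg f x θ₀
              - reg f x
                (iterate f x y η θ₀ (fun s => idx s ω) (fun s => ξ s ω) ⌊η ^ (-1.6 : ℝ)⌋₊)
              - c₂ * η ^ (0.4 : ℝ)| ≤ r η}ᶜ
        ≤ ENNReal.ofReal (Real.exp (-(η ^ (-κ))))

/-- The subspace of directions in which, at `θs`, the prediction at every training input has zero
derivative. -/
def flatDirections {d n : ℕ} {X : Type*} (f : Param d → X → ℝ) (x : Fin n → X) (θs : Param d) :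
    Submodule ℝ (Param d) :=
  (Submodule.span ℝ (Set.range fun i => ∇ (fun ϑ => f ϑ (x i)) θs))ᗮ

/-- The gradient of the regularizer at `θs` vanishes in all flat directions. -/
def RegStationary {d n : ℕ} {X : Type*} (f : Param d → X → ℝ) (x : Fin n → X) (θs : Param d) :
    Prop :=
  ∀ v ∈ flatDirections f x θs, inner ℝ (∇ (reg f x) θs) v = 0

end LabelNoiseSGD

end

/-! ### Second-order remainders and averages over the data. -/

namespace LabelNoiseSGD

/-! Write `p = θ - θs`, let `a i` and `H i` be the gradient and Hessian of the `i`-th prediction at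
`θs`, and let `A` be the average of the rank-one operators `a i ⊗ a i`. To leading order a step
sends `p` to `p - 2η⟨a i, p⟩ a i + 2ηξ a i`. Along an eigenvector of `A` with positive eigenvalue
this is a contraction with noise, and the coordinate stays near the scale `η^0.5`. A vector `e` in
the kernel of `A` is orthogonal to every `a i`, so its mean motion begins with the quadratic term
`-2η avg ⟨a i, p⟩⟨e, H i p⟩`.

This term fluctuates with `p`. Instead of averaging it over a stationary law, the proof removes it
with a corrector: `exists_lyapunov` gives a symmetric form `γ` such that `⟨e, p⟩ - γ(p, p)` has mean
increment `-η² w` up to `O(η‖p‖³ + η²‖p‖)` (`Expansion.flat_mean`). Here `w = 4 avg γ(a i, a i) = 2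
avg ⟨a i, H i e⟩`, which is the derivative of the regularizer along `e`. Label noise thus becomes a
drift that decreases the regularizer along the flat directions; over `η^(-1.6)` steps it moves the
coordinate by `-w η^0.4`.

An exponential moment bound for the recursion, killed on leaving the ball of radius `η^0.39`
(`measure_staysIn_inter_le`), keeps every observable below `η^0.46` with overwhelming probability. A
union bound over times and directions, with the deterministic bootstrap
`Expansion.path_follows_drift`, shows that the path never leaves that ball. If all `w j` vanish, the
coordinates stay below `2η^0.46`. Otherwise some coordinate moves by order `η^0.4`, and a
first-order expansion of the regularizer gives a decrease of `(∑ j, w j ^ 2) η^0.4`. -/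

/-- A function that is twice continuously differentiable at a point agrees with its affine
approximation there up to a quadratic error. -/
theorem exists_norm_sub_fderiv_le {E F : Type*} [NormedAddCommGroup E] [NormedSpace ℝ E]
    [NormedAddCommGroup F] [NormedSpace ℝ F] {g : E → F} {x : E} (hg : ContDiffAt ℝ 2 g x) :
    ∃ C : ℝ, 0 ≤ C ∧ ∀ᶠ y in 𝓝 x,
      ‖g y - g x - fderiv ℝ g x (y - x)‖ ≤ C * ‖y - x‖ ^ 2 := by
  have h1 : ContDiffAt ℝ 1 (fderiv ℝ g) x := hg.fderiv_right (by norm_num)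
  obtain ⟨K, t, ht, hK⟩ := h1.exists_lipschitzOnWith
  have hd : ∀ᶠ y in 𝓝 x, DifferentiableAt ℝ g y := by
    have := hg.eventually (by simp)
    filter_upwards [this] with y hy using hy.differentiableAt (by simp)
  obtain ⟨r, hr, hball⟩ := Metric.nhds_basis_closedBall.mem_iff.1 (inter_mem ht hd)
  refine ⟨K, K.2, mem_of_superset (Metric.closedBall_mem_nhds x hr) fun y hy' => ?_⟩
  have hy : ‖y - x‖ ≤ r := by simpa [dist_eq_norm] using hy'
  have hsub : Metric.closedBall x ‖y - x‖ ⊆ t ∩ {y | DifferentiableAt ℝ g y} :=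
    (Metric.closedBall_subset_closedBall hy).trans hball
  have hyb : y ∈ Metric.closedBall x ‖y - x‖ := by simp [dist_eq_norm]
  have hxb : x ∈ Metric.closedBall x ‖y - x‖ := by simp
  -- Mean value inequality on the ball of radius `‖y - x‖`: there the Lipschitz derivative differs
  -- from `fderiv ℝ g x` by at most `K * ‖y - x‖`.
  have := (convex_closedBall x ‖y - x‖).norm_image_sub_le_of_norm_hasFDerivWithin_le'
    (f := g) (f' := fderiv ℝ g) (φ := fderiv ℝ g x) (C := K * ‖y - x‖) (x := x) (y := y)
    (fun z hz => ((hsub hz).2.hasFDerivAt).hasFDerivWithinAt)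
    (fun z hz => by
      have h2 := hK.norm_sub_le (hsub hz).1 (hsub hxb).1
      refine h2.trans ?_
      have : ‖z - x‖ ≤ ‖y - x‖ := by simpa [dist_eq_norm] using hz
      gcongr)
    hxb hyb
  calc _ ≤ _ := this
    _ = _ := by ring

/-- The average of a finite family of reals. -/
noncomputable def avg {n : ℕ} (u : Fin n → ℝ) : ℝ := (n : ℝ)⁻¹ * ∑ i, u i

section avg
variable {n : ℕ} (u v : Fin n → ℝ)

theorem avg_add : avg (fun i => u i + v i) = avg u + avg v := by
  simp [avg, Finset.sum_add_distrib, mul_add]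

theorem avg_sub : avg (fun i => u i - v i) = avg u - avg v := by
  simp [avg, Finset.sum_sub_distrib, mul_sub]

theorem avg_const_mul (c : ℝ) : avg (fun i => c * u i) = c * avg u := by
  simp only [avg, ← Finset.mul_sum]; ring

theorem avg_const (hn : n ≠ 0) (c : ℝ) : avg (fun _ : Fin n => c) = c := by
  have : (n : ℝ) ≠ 0 := by exact_mod_cast hn
  simp [avg]; field_simp

theorem avg_sum {ι : Type*} (s : Finset ι) (w : ι → Fin n → ℝ) :
    avg (fun i => ∑ k ∈ s, w k i) = ∑ k ∈ s, avg (w k) := by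
  simp only [avg]; rw [Finset.sum_comm, Finset.mul_sum]

variable {u v} in
theorem abs_avg_le (hn : n ≠ 0) {c : ℝ} (h : ∀ i, |u i| ≤ c) : |avg u| ≤ c := by
  have hn' : (0 : ℝ) < n := by exact_mod_cast Nat.pos_of_ne_zero hn
  rw [avg, abs_mul, abs_of_pos (inv_pos.2 hn'), inv_mul_le_iff₀ hn']
  calc |∑ i, u i| ≤ ∑ i, |u i| := Finset.abs_sum_le_sum_abs _ _
    _ ≤ ∑ _i : Fin n, c := Finset.sum_le_sum fun i _ => h i
    _ = n * c := by simp

variable {u v} in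
theorem eq_zero_of_avg_sq_eq_zero (hn : n ≠ 0) (h : avg (fun i => u i ^ 2) = 0) (i : Fin n) :
    u i = 0 := by
  have hn' : (n : ℝ)⁻¹ ≠ 0 := inv_ne_zero (by exact_mod_cast hn)
  have h2 := (mul_eq_zero.1 h).resolve_left hn'
  have := (Finset.sum_eq_zero_iff_of_nonneg (fun i _ => sq_nonneg (u i))).1 h2 i (Finset.mem_univ i)
  simpa using this

end avg

/-! ### The second moment operator and its Lyapunov equation. -/

/-- Spectral decomposition of the second moment matrix of a finite family of vectors. -/
theorem exists_eigenbasis {d n : ℕ} (a : Fin n → Param d) :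
    ∃ (e : OrthonormalBasis (Fin d) ℝ (Param d)) (l : Fin d → ℝ), (∀ j, 0 ≤ l j) ∧
      ∀ j p, avg (fun i => inner ℝ (a i) p * inner ℝ (e j) (a i)) = l j * inner ℝ (e j) p := by
  let A : Param d →ₗ[ℝ] Param d :=
    (n : ℝ)⁻¹ • ∑ i, ((innerₛₗ ℝ (a i)).smulRight (a i) : Param d →ₗ[ℝ] Param d)
  have hA : ∀ q p, inner ℝ q (A p) = avg (fun i => inner ℝ (a i) p * inner ℝ q (a i)) := by
    intro q p
    simp [A, avg, inner_sum, inner_smul_right]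
  have hsymm : A.IsSymmetric := by
    intro p q
    rw [real_inner_comm, hA, hA]
    congr 1; ext i
    rw [real_inner_comm q, real_inner_comm p, mul_comm]
  have hd : Module.finrank ℝ (Param d) = d := by simp
  have key : ∀ j p, avg (fun i => inner ℝ (a i) p * inner ℝ (hsymm.eigenvectorBasis hd j) (a i))
      = hsymm.eigenvalues hd j * inner ℝ (hsymm.eigenvectorBasis hd j) p := by
    intro j p
    rw [← hA, ← hsymm, hsymm.apply_eigenvectorBasis hd j]
    simp [inner_smul_left]
  refine ⟨hsymm.eigenvectorBasis hd, hsymm.eigenvalues hd, fun j => ?_, key⟩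
  have := key j (hsymm.eigenvectorBasis hd j)
  rw [real_inner_self_eq_norm_sq, OrthonormalBasis.norm_eq_one] at this
  rw [one_pow, mul_one] at this
  rw [← this, avg]
  refine mul_nonneg (by positivity) (Finset.sum_nonneg fun i _ => ?_)
  rw [real_inner_comm]
  exact mul_self_nonneg _

/-- Solution of the Lyapunov equation of the second moment matrix of the family `a`. -/
theorem exists_lyapunov {d n : ℕ} (hn : n ≠ 0) {a : Fin n → Param d} (c : Fin n → Param d)
    {e : OrthonormalBasis (Fin d) ℝ (Param d)} {l : Fin d → ℝ} (hl : ∀ j, 0 ≤ l j)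
    (he : ∀ j p, avg (fun i => inner ℝ (a i) p * inner ℝ (e j) (a i)) = l j * inner ℝ (e j) p) :
    ∃ γ : LinearMap.BilinForm ℝ (Param d), (∀ p q, γ p q = γ q p) ∧
      (∀ p, 2 * avg (fun i => inner ℝ (a i) p * γ p (a i)) =
        avg (fun i => inner ℝ (a i) p * inner ℝ (c i) p)) ∧
      2 * avg (fun i => γ (a i) (a i)) = avg (fun i => inner ℝ (a i) (c i)) := by
  -- In the eigenbasis the Lyapunov operator is diagonal: it multiplies entry `(k, m)` by `l k + l
  -- m`. The right side is symmetrized, since only its quadratic form matters. If `l k + l m = 0`,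
  -- the division yields `0`, which is still a solution because the right side vanishes there too.
  let β : Fin d → Fin d → ℝ := fun k m => avg (fun i => inner ℝ (a i) (e k) * inner ℝ (c i) (e m))
  let μ : Fin d → Fin d → ℝ := fun k m => (β k m + β m k) / (2 * (l k + l m))
  have hμs : ∀ k m, μ k m = μ m k := fun k m => by
    simp only [μ]; rw [add_comm (β k m), add_comm (l k)]
  -- The eigenvalue `l k` is the average of the squares `⟨a i, e k⟩²`.
  have hz : ∀ k, l k = 0 → ∀ i, inner ℝ (a i) (e k) = 0 := by
    intro k hk
    refine eq_zero_of_avg_sq_eq_zero hn ?_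
    have := he k (e k)
    rw [hk, zero_mul] at this
    rw [← this]; congr 1; ext i
    rw [real_inner_comm (a i) (e k), sq]
  have hβz : ∀ k m, l k = 0 → β k m = 0 := fun k m hk => by
    simp [β, hz k hk, avg]
  have hμ : ∀ k m, μ k m * (l k + l m) = (β k m + β m k) / 2 := by
    intro k m
    by_cases h : l k + l m = 0
    · have hk : l k = 0 := by linarith [hl k, hl m]
      have hm : l m = 0 := by linarith [hl k, hl m]
      rw [h, hβz k m hk, hβz m k hm]; simp
    · simp only [μ]; field_simp
  let γ : LinearMap.BilinForm ℝ (Param d) := LinearMap.mk₂ ℝ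
    (fun p q => ∑ k, ∑ m, μ k m * (inner ℝ (e k) p * inner ℝ (e m) q))
    (fun p p' q => by simp only [inner_add_right, add_mul, mul_add, Finset.sum_add_distrib])
    (fun r p q => by
      simp only [inner_smul_right, smul_eq_mul, Finset.mul_sum]
      congr! 2; ring)
    (fun p q q' => by simp only [inner_add_right, mul_add, Finset.sum_add_distrib])
    (fun r p q => by
      simp only [inner_smul_right, smul_eq_mul, Finset.mul_sum]
      congr! 2; ring)
  have hγ : ∀ p q, γ p q = ∑ k, ∑ m, μ k m * (inner ℝ (e k) p * inner ℝ (e m) q) := fun _ _ => rfl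
  refine ⟨γ, fun p q => ?_, fun p => ?_, ?_⟩
  · rw [hγ, hγ, Finset.sum_comm]
    congr! 2 with k _ m _
    rw [hμs]; ring
  · have h1 : avg (fun i => inner ℝ (a i) p * γ p (a i)) =
        ∑ k, ∑ m, μ k m * l m * (inner ℝ (e k) p * inner ℝ (e m) p) := by
      have : ∀ i, inner ℝ (a i) p * γ p (a i) = ∑ k, ∑ m, μ k m * inner ℝ (e k) p *
          (inner ℝ (a i) p * inner ℝ (e m) (a i)) := fun i => by
        rw [hγ]; simp only [Finset.mul_sum]; congr! 2; ring
      simp only [this, avg_sum, avg_const_mul, he]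
      congr! 2; ring
    have h2 : avg (fun i => inner ℝ (a i) p * γ p (a i)) =
        ∑ k, ∑ m, μ k m * l k * (inner ℝ (e k) p * inner ℝ (e m) p) := by
      rw [h1, Finset.sum_comm]
      congr! 2 with k _ m _
      rw [hμs]; ring
    have h3 : avg (fun i => inner ℝ (a i) p * inner ℝ (c i) p) =
        ∑ k, ∑ m, β k m * (inner ℝ (e k) p * inner ℝ (e m) p) := by
      have : ∀ i, inner ℝ (a i) p * inner ℝ (c i) p = ∑ k, ∑ m, (inner ℝ (e k) p * inner ℝ (e m) p) *
          (inner ℝ (a i) (e k) * inner ℝ (c i) (e m)) := fun i => by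
        rw [← e.sum_inner_mul_inner (a i) p, ← e.sum_inner_mul_inner (c i) p,
          Finset.sum_mul_sum]
        congr! 2; ring
      simp only [this, avg_sum, avg_const_mul]
      congr! 2; rw [mul_comm]
    have h4 : avg (fun i => inner ℝ (a i) p * inner ℝ (c i) p) =
        ∑ k, ∑ m, β m k * (inner ℝ (e k) p * inner ℝ (e m) p) := by
      rw [h3, Finset.sum_comm]
      congr! 2; ring
    rw [two_mul]
    nth_rewrite 1 [h1]
    rw [h2]
    have h5 : avg (fun i => inner ℝ (a i) p * inner ℝ (c i) p) =
        ∑ k, ∑ m, (β k m + β m k) / 2 * (inner ℝ (e k) p * inner ℝ (e m) p) := by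
      have : ∀ k m, (β k m + β m k) / 2 * (inner ℝ (e k) p * inner ℝ (e m) p) =
        2⁻¹ * (β k m * (inner ℝ (e k) p * inner ℝ (e m) p)) +
        2⁻¹ * (β m k * (inner ℝ (e k) p * inner ℝ (e m) p)) := fun k m => by ring
      simp only [this, Finset.sum_add_distrib, ← Finset.mul_sum, ← h3, ← h4]
      ring
    rw [h5, ← Finset.sum_add_distrib]
    refine Finset.sum_congr rfl fun k _ => ?_
    rw [← Finset.sum_add_distrib]
    refine Finset.sum_congr rfl fun m _ => ?_
    rw [← hμ]; ring
  -- By orthonormality only diagonal entries survive in the trace, where the equation reads `2 * μ k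
  -- k * l k = β k k`.
  · have h1 : avg (fun i => γ (a i) (a i)) = ∑ k, μ k k * l k := by
      have : ∀ i, γ (a i) (a i) = ∑ k, ∑ m, μ k m *
          (inner ℝ (a i) (e k) * inner ℝ (e m) (a i)) := fun i => by
        rw [hγ]; congr! 2; rw [real_inner_comm]
      simp only [this, avg_sum, avg_const_mul, he]
      congr! 2 with k _
      simp [orthonormal_iff_ite.1 e.orthonormal]
    have h2 : avg (fun i => inner ℝ (a i) (c i)) = ∑ k, β k k := by
      simp only [β, ← avg_sum]
      congr 1; ext i
      rw [← e.sum_inner_mul_inner (a i) (c i)]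
      congr! 2; rw [real_inner_comm]
    rw [h1, h2, Finset.mul_sum]
    congr! 1 with k _
    have := hμ k k
    linarith

/-! ### Concentration for random recursions killed on leaving a set. -/

/-- Bernstein type bound for the exponential moment of a bounded variable of small mean. -/
theorem lintegral_exp_le {Ω : Type*} [MeasurableSpace Ω] {P : Measure Ω} [IsProbabilityMeasure P]
    {D : Ω → ℝ} (hD : Measurable D) {K δ s : ℝ} (hK : ∀ᵐ ω ∂P, |D ω| ≤ K)
    (hδ : |∫ ω, D ω ∂P| ≤ δ) (hs : |s| * K ≤ 1) :
    ∫⁻ ω, ENNReal.ofReal (Real.exp (s * D ω)) ∂P ≤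
      ENNReal.ofReal (Real.exp (|s| * δ + s ^ 2 * K ^ 2)) := by
  have hDi : Integrable D P :=
    Integrable.of_bound hD.aestronglyMeasurable K (by simpa [Real.norm_eq_abs] using hK)
  -- Uses `exp z ≤ 1 + z + z²` for `|z| ≤ 1`.
  have hbd : ∀ᵐ ω ∂P, Real.exp (s * D ω) ≤ 1 + s * D ω + s ^ 2 * K ^ 2 := by
    filter_upwards [hK] with ω hω
    have h1 : |s * D ω| ≤ 1 := by
      rw [abs_mul]; exact (mul_le_mul_of_nonneg_left hω (abs_nonneg s)).trans hs
    have h2 := (abs_le.1 (Real.abs_exp_sub_one_sub_id_le h1)).2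
    have h3 : (s * D ω) ^ 2 ≤ s ^ 2 * K ^ 2 := by
      rw [mul_pow]
      refine mul_le_mul_of_nonneg_left ?_ (sq_nonneg s)
      rw [← sq_abs (D ω)]
      exact pow_le_pow_left₀ (abs_nonneg _) hω 2
    linarith
  have hint : Integrable (fun ω => 1 + s * D ω + s ^ 2 * K ^ 2) P :=
    ((integrable_const _).add (hDi.const_mul s)).add (integrable_const _)
  have hnn : 0 ≤ᵐ[P] fun ω => 1 + s * D ω + s ^ 2 * K ^ 2 := by
    filter_upwards [hbd] with ω hω using (Real.exp_pos _).le.trans hω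
  calc _ ≤ ∫⁻ ω, ENNReal.ofReal (1 + s * D ω + s ^ 2 * K ^ 2) ∂P := by
        refine lintegral_mono_ae ?_
        filter_upwards [hbd] with ω hω using ENNReal.ofReal_le_ofReal hω
    _ = ENNReal.ofReal (∫ ω, (1 + s * D ω + s ^ 2 * K ^ 2) ∂P) :=
        (ofReal_integral_eq_lintegral_ofReal hint hnn).symm
    _ ≤ _ := by
        refine ENNReal.ofReal_le_ofReal ?_
        have h3 : ∫ ω, (1 + s * D ω + s ^ 2 * K ^ 2) ∂P =
            1 + s * ∫ ω, D ω ∂P + s ^ 2 * K ^ 2 := by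
          rw [integral_add (f := fun ω => 1 + s * D ω)
            ((integrable_const _).add (hDi.const_mul s)) (integrable_const _),
            integral_add (integrable_const _) (hDi.const_mul s), integral_const_mul]
          simp only [integral_const, probReal_univ, smul_eq_mul, one_mul]
        rw [h3]
        have h4 : s * ∫ ω, D ω ∂P ≤ |s| * δ := by
          refine (le_abs_self _).trans ?_
          rw [abs_mul]; exact mul_le_mul_of_nonneg_left hδ (abs_nonneg s)
        have h5 := Real.add_one_le_exp (|s| * δ + s ^ 2 * K ^ 2)
        linarith

/-- Integrating out a variable that is independent of the rest. -/
theorem lintegral_le_of_indepFun {Ω α β : Type*} [MeasurableSpace Ω] [MeasurableSpace α]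
    [MeasurableSpace β] {P : Measure Ω} [IsProbabilityMeasure P] {Y : Ω → α} {Z : Ω → β}
    (hY : Measurable Y) (hZ : Measurable Z) (hind : IndepFun Y Z P) {k : α → β → ℝ≥0∞}
    (hk : Measurable (Function.uncurry k)) {u : α → ℝ≥0∞}
    (h : ∀ y, ∫⁻ ω, k y (Z ω) ∂P ≤ u y) :
    ∫⁻ ω, k (Y ω) (Z ω) ∂P ≤ ∫⁻ ω, u (Y ω) ∂P := by
  have hmap := (indepFun_iff_map_prod_eq_prod_map_map hY.aemeasurable hZ.aemeasurable).1 hind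
  have : IsProbabilityMeasure (P.map Z) := Measure.isProbabilityMeasure_map hZ.aemeasurable
  calc ∫⁻ ω, k (Y ω) (Z ω) ∂P = ∫⁻ q, Function.uncurry k q ∂(P.map fun ω => (Y ω, Z ω)) := by
        rw [lintegral_map hk (hY.prodMk hZ)]; rfl
    _ = ∫⁻ y, ∫⁻ z, k y z ∂(P.map Z) ∂(P.map Y) := by
        rw [hmap, lintegral_prod _ hk.aemeasurable]; rfl
    _ = ∫⁻ ω, ∫⁻ z, k (Y ω) z ∂(P.map Z) ∂P := by
        exact lintegral_map hk.lintegral_prod_right' hY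
    _ ≤ _ := by
        refine lintegral_mono fun ω => ?_
        exact (lintegral_map (hk.comp measurable_prodMk_left) hZ).trans_le (h (Y ω))

/-- The path of a random recursion with step map `S`, driven by the sequence `z`. -/
def path {α β : Type*} (S : α → β → α) (p₀ : α) (z : ℕ → β) : ℕ → α
  | 0 => p₀
  | t + 1 => S (path S p₀ z t) (z t)

section path
variable {Ω α β : Type*} [mΩ : MeasurableSpace Ω] [MeasurableSpace α] [mβ : MeasurableSpace β]
  {S : α → β → α} {p₀ : α} {Z : ℕ → Ω → β}

/-- The information generated by the first `t` steps. -/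
abbrev past (Z : ℕ → Ω → β) (t : ℕ) : MeasurableSpace Ω :=
  ⨆ s ∈ Set.Iio t, MeasurableSpace.comap (Z s) mβ

omit mΩ in
theorem past_mono {s t : ℕ} (h : s ≤ t) : past Z s ≤ past Z t :=
  biSup_mono fun _ hr => lt_of_lt_of_le hr h

theorem past_le (hZ : ∀ t, Measurable (Z t)) (t : ℕ) : past Z t ≤ mΩ :=
  iSup₂_le fun s _ => (hZ s).comap_le

omit mΩ in
theorem measurable_path_past (hS : Measurable (Function.uncurry S)) (t : ℕ) :
    Measurable[past Z t] fun ω => path S p₀ (fun s => Z s ω) t := by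
  induction t with
  | zero => exact measurable_const
  | succ t ih =>
    have h1 : Measurable[past Z (t + 1)] fun ω => path S p₀ (fun s => Z s ω) t :=
      ih.mono (past_mono t.le_succ) le_rfl
    have h2 : Measurable[past Z (t + 1)] (Z t) :=
      Measurable.mono (comap_measurable (Z t))
        (le_biSup (fun s => MeasurableSpace.comap (Z s) mβ) (Set.mem_Iio.2 t.lt_succ_self)) le_rfl
    exact hS.comp (h1.prodMk h2)

/-- The event that the first `t` points of the path lie in `B`. -/
def staysIn (S : α → β → α) (p₀ : α) (Z : ℕ → Ω → β) (B : Set α) (t : ℕ) : Set Ω :=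
  {ω | ∀ r < t, path S p₀ (fun s => Z s ω) r ∈ B}

omit mΩ in
theorem measurableSet_staysIn_past (hS : Measurable (Function.uncurry S)) {B : Set α}
    (hB : MeasurableSet B) (t : ℕ) : MeasurableSet[past Z t] (staysIn S p₀ Z B (t + 1)) := by
  have : staysIn S p₀ Z B (t + 1) =
      ⋂ r, ⋂ (_ : r < t + 1), (fun ω => path S p₀ (fun s => Z s ω) r) ⁻¹' B := by
    ext ω; simp [staysIn]
  rw [this]
  refine MeasurableSet.iInter fun r => MeasurableSet.iInter fun hr => ?_
  exact ((measurable_path_past hS r).mono (past_mono (Nat.lt_succ_iff.1 hr)) le_rfl) hB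

theorem measurableSet_staysIn (hS : Measurable (Function.uncurry S)) (hZ : ∀ t, Measurable (Z t))
    {B : Set α} (hB : MeasurableSet B) (t : ℕ) : MeasurableSet (staysIn S p₀ Z B t) := by
  cases t with
  | zero => simp [staysIn]
  | succ t => exact past_le hZ t _ (measurableSet_staysIn_past hS hB t)

variable {P : Measure Ω} [IsProbabilityMeasure P]

omit [IsProbabilityMeasure P] in
theorem indep_past (hZ : ∀ t, Measurable (Z t)) (hind : iIndepFun Z P) (t : ℕ) :
    Indep (past Z t) (MeasurableSpace.comap (Z t) mβ) P := by
  have := indep_iSup_of_disjoint (fun s => (hZ s).comap_le) ((iIndepFun_iff_iIndep _ Z P).1 hind)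
    (S := Set.Iio t) (T := {t}) (by simp)
  simpa [past] using this

/-- Exponential moment of an observable `h` of a random recursion, killed when the recursion
leaves the set `B`. In each step the observable is contracted by `ρ`, up to a variable
bounded by `K` with mean bounded by `δ`. -/
theorem lintegral_staysIn_exp_le (hS : Measurable (Function.uncurry S))
    (hZ : ∀ t, Measurable (Z t)) (hind : iIndepFun Z P) {B : Set α} (hB : MeasurableSet B)
    {h : ℕ → α → ℝ} (hh : ∀ t, Measurable (h t)) {ρ K δ : ℝ} (hρ : 0 ≤ ρ) (hρ1 : ρ ≤ 1)
    (hK0 : 0 ≤ K)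
    (hK : ∀ t, ∀ p ∈ B, ∀ᵐ ω ∂P, |h (t + 1) (S p (Z t ω)) - ρ * h t p| ≤ K)
    (hδ : ∀ t, ∀ p ∈ B, |∫ ω, (h (t + 1) (S p (Z t ω)) - ρ * h t p) ∂P| ≤ δ)
    (t : ℕ) (s : ℝ) (hs : |s| * K ≤ 1) :
    ∫⁻ ω in staysIn S p₀ Z B t, ENNReal.ofReal (Real.exp (s * h t (path S p₀ (fun r => Z r ω) t))) ∂P
      ≤ ENNReal.ofReal (Real.exp (s * ρ ^ t * h 0 p₀ +
          (|s| * δ + s ^ 2 * K ^ 2) * ∑ k ∈ Finset.range t, ρ ^ k)) := by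
  -- Integrating out the last step replaces `s` by `s * ρ`, so the exponent must vary in the
  -- induction.
  induction t generalizing s with
  | zero => simp [staysIn, path]
  | succ t ih =>
    let G := staysIn S p₀ Z B (t + 1)
    have hG : MeasurableSet[past Z t] G := measurableSet_staysIn_past hS hB t
    have hG' : MeasurableSet G := past_le hZ t _ hG
    -- The survival indicator belongs to the state: it is determined by the steps before `t`, so the
    -- pair is independent of `Z t`.
    let Y : Ω → α × ℝ≥0∞ := fun ω => (path S p₀ (fun r => Z r ω) t, G.indicator 1 ω)
    have hYp : Measurable[past Z t] Y :=
      (measurable_path_past hS t).prodMk ((measurable_const (a := (1 : ℝ≥0∞))).indicator hG)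
    have hY : Measurable Y := hYp.mono (past_le hZ t) le_rfl
    have hindYZ : IndepFun Y (Z t) P := by
      rw [IndepFun_iff_Indep]
      exact indep_of_indep_of_le_left (indep_past hZ hind t) hYp.comap_le
    -- The factor `B.indicator` is redundant along surviving paths, but makes the one-step bound
    -- valid for every `y`.
    let k : α × ℝ≥0∞ → β → ℝ≥0∞ := fun y z =>
      B.indicator 1 y.1 * y.2 * ENNReal.ofReal (Real.exp (s * h (t + 1) (S y.1 z)))
    let c : ℝ := |s| * δ + s ^ 2 * K ^ 2
    let u : α × ℝ≥0∞ → ℝ≥0∞ := fun y =>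
      y.2 * (ENNReal.ofReal (Real.exp c) * ENNReal.ofReal (Real.exp (s * ρ * h t y.1)))
    have hBm : Measurable (B.indicator (1 : α → ℝ≥0∞)) := measurable_const.indicator hB
    have hkm : Measurable (Function.uncurry k) := by
      have h1 : Measurable fun q : (α × ℝ≥0∞) × β => S q.1.1 q.2 :=
        hS.comp ((measurable_fst.comp measurable_fst).prodMk measurable_snd)
      exact ((hBm.comp (measurable_fst.comp measurable_fst)).mul
        (measurable_snd.comp measurable_fst)).mul
        (Real.measurable_exp.comp (((hh (t + 1)).comp h1).const_mul s)).ennreal_ofReal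
    have hku : ∀ y, ∫⁻ ω, k y (Z t ω) ∂P ≤ u y := by
      intro y
      by_cases hy : y.1 ∈ B
      · have hSm : Measurable fun ω => S y.1 (Z t ω) :=
          hS.comp (measurable_const.prodMk (hZ t))
        have hDm : Measurable fun ω => h (t + 1) (S y.1 (Z t ω)) - ρ * h t y.1 :=
          ((hh (t + 1)).comp hSm).sub_const _
        have h1 := lintegral_exp_le hDm (hK t y.1 hy) (hδ t y.1 hy) hs
        have h2 : ∀ ω, k y (Z t ω) = y.2 * ENNReal.ofReal (Real.exp (s * ρ * h t y.1)) *
            ENNReal.ofReal (Real.exp (s * (h (t + 1) (S y.1 (Z t ω)) - ρ * h t y.1))) := by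
          intro ω
          rw [mul_assoc, ← ENNReal.ofReal_mul (Real.exp_pos _).le, ← Real.exp_add]
          simp only [k, Set.indicator_of_mem hy, Pi.one_apply, one_mul]
          congr 3; ring
        simp only [h2]
        have hem : Measurable fun ω => ENNReal.ofReal
            (Real.exp (s * (h (t + 1) (S y.1 (Z t ω)) - ρ * h t y.1))) :=
          (Real.measurable_exp.comp (hDm.const_mul s)).ennreal_ofReal
        rw [lintegral_const_mul _ hem, mul_assoc]
        refine mul_le_mul_right ?_ _
        rw [mul_comm]
        exact mul_le_mul_left h1 _
      · simp [k, hy]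
    have hsub : G ⊆ staysIn S p₀ Z B t := fun ω hω r hr => hω r (hr.trans t.lt_succ_self)
    have hsρ : |s * ρ| * K ≤ 1 := by
      rw [abs_mul, abs_of_nonneg hρ]
      exact (mul_le_mul_of_nonneg_right
        (mul_le_of_le_one_right (abs_nonneg s) hρ1) hK0).trans hs
    calc _ = ∫⁻ ω, k (Y ω) (Z t ω) ∂P := by
          rw [← lintegral_indicator hG']
          refine lintegral_congr fun ω => ?_
          by_cases hω : ω ∈ G
          · have hpB : path S p₀ (fun r => Z r ω) t ∈ B := hω t t.lt_succ_self
            simp only [k, Y, Set.indicator_of_mem hω, Set.indicator_of_mem hpB, Pi.one_apply,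
              one_mul, path]
          · simp only [k, Y, Set.indicator_of_notMem hω, mul_zero, zero_mul]
      _ ≤ ∫⁻ ω, u (Y ω) ∂P := lintegral_le_of_indepFun hY (hZ t) hindYZ hkm hku
      _ = ENNReal.ofReal (Real.exp c) * ∫⁻ ω in G,
            ENNReal.ofReal (Real.exp (s * ρ * h t (path S p₀ (fun r => Z r ω) t))) ∂P := by
          have hm : Measurable fun ω => ENNReal.ofReal
              (Real.exp (s * ρ * h t (path S p₀ (fun r => Z r ω) t))) :=
            (Real.measurable_exp.comp (((hh t).comp ((measurable_path_past hS t).mono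
              (past_le hZ t) le_rfl)).const_mul (s * ρ))).ennreal_ofReal
          rw [← lintegral_indicator hG', ← lintegral_const_mul _ (hm.indicator hG')]
          refine lintegral_congr fun ω => ?_
          by_cases hω : ω ∈ G
          · simp only [u, Y, Set.indicator_of_mem hω, Pi.one_apply, one_mul]
          · simp only [u, Y, Set.indicator_of_notMem hω, mul_zero, zero_mul]
      _ ≤ ENNReal.ofReal (Real.exp c) * ENNReal.ofReal (Real.exp (s * ρ * ρ ^ t * h 0 p₀ +
            (|s * ρ| * δ + (s * ρ) ^ 2 * K ^ 2) * ∑ k ∈ Finset.range t, ρ ^ k)) :=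
          mul_le_mul_right ((lintegral_mono_set hsub).trans (ih (s * ρ) hsρ)) _
      _ ≤ _ := by
          rw [← ENNReal.ofReal_mul (Real.exp_pos _).le, ← Real.exp_add]
          refine ENNReal.ofReal_le_ofReal (Real.exp_le_exp.2 ?_)
          rw [Finset.sum_range_succ']
          have h6 : ∑ k ∈ Finset.range t, ρ ^ (k + 1) = ρ * ∑ k ∈ Finset.range t, ρ ^ k := by
            rw [Finset.mul_sum]; exact Finset.sum_congr rfl fun k _ => by ring
          have h7 : 0 ≤ ∑ k ∈ Finset.range t, ρ ^ k :=
            Finset.sum_nonneg fun k _ => pow_nonneg hρ k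
          -- As `0 ≤ ρ ≤ 1`, the cost at `s * ρ` is at most `ρ` times the cost at `s`. This shifts
          -- the geometric sum by one, and the cost `c` of the step just integrated supplies its
          -- zeroth term.
          have h8 : |s * ρ| * δ + (s * ρ) ^ 2 * K ^ 2 ≤ c * ρ := by
            have : s ^ 2 * K ^ 2 * (ρ * ρ) ≤ s ^ 2 * K ^ 2 * ρ :=
              mul_le_mul_of_nonneg_left (mul_le_of_le_one_right hρ hρ1) (by positivity)
            rw [abs_mul, abs_of_nonneg hρ]
            simp only [c]
            linarith
          have h9 := mul_le_mul_of_nonneg_right h8 h7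
          have h10 : s * ρ ^ (t + 1) * h 0 p₀ = s * ρ * ρ ^ t * h 0 p₀ := by ring
          rw [h6, pow_zero, h10]
          simp only [c] at h9 ⊢
          linarith

/-- Concentration of an observable of a random recursion, as long as it stays in `B`. -/
theorem measure_staysIn_inter_le (hS : Measurable (Function.uncurry S))
    (hZ : ∀ t, Measurable (Z t)) (hind : iIndepFun Z P) {B : Set α} (hB : MeasurableSet B)
    {h : ℕ → α → ℝ} (hh : ∀ t, Measurable (h t)) {ρ K δ : ℝ} (hρ : 0 ≤ ρ) (hρ1 : ρ ≤ 1)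
    (hK0 : 0 ≤ K) (hδ0 : 0 ≤ δ)
    (hK : ∀ t, ∀ p ∈ B, ∀ᵐ ω ∂P, |h (t + 1) (S p (Z t ω)) - ρ * h t p| ≤ K)
    (hδ : ∀ t, ∀ p ∈ B, |∫ ω, (h (t + 1) (S p (Z t ω)) - ρ * h t p) ∂P| ≤ δ)
    (t : ℕ) {N s b : ℝ} (hN : ∑ k ∈ Finset.range t, ρ ^ k ≤ N) (hs0 : 0 ≤ s) (hs : s * K ≤ 1) :
    P (staysIn S p₀ Z B t ∩ {ω | b ≤ |h t (path S p₀ (fun r => Z r ω) t)|}) ≤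
      ENNReal.ofReal (2 * Real.exp (s * |h 0 p₀| + (s * δ + s ^ 2 * K ^ 2) * N - s * b)) := by
  have hpath : Measurable fun ω => h t (path S p₀ (fun r => Z r ω) t) :=
    (hh t).comp ((measurable_path_past hS t).mono (past_le hZ t) le_rfl)
  -- Chernoff's inequality for each sign of the observable.
  have one_side : ∀ σ : ℝ, |σ| = 1 →
      P (staysIn S p₀ Z B t ∩ {ω | b ≤ σ * h t (path S p₀ (fun r => Z r ω) t)}) ≤
      ENNReal.ofReal (Real.exp (s * |h 0 p₀| + (s * δ + s ^ 2 * K ^ 2) * N - s * b)) := by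
    intro σ hσ
    have habs : |s * σ| = s := by rw [abs_mul, hσ, mul_one, abs_of_nonneg hs0]
    have hm := lintegral_staysIn_exp_le (p₀ := p₀) hS hZ hind hB hh hρ hρ1 hK0 hK hδ t (s * σ)
      (by rwa [habs])
    have hfm : Measurable fun ω =>
        ENNReal.ofReal (Real.exp (s * σ * h t (path S p₀ (fun r => Z r ω) t))) :=
      (Real.measurable_exp.comp (hpath.const_mul _)).ennreal_ofReal
    have hmk := mul_meas_ge_le_lintegral (μ := P.restrict (staysIn S p₀ Z B t)) hfm
      (ENNReal.ofReal (Real.exp (s * b)))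
    have hsub : staysIn S p₀ Z B t ∩ {ω | b ≤ σ * h t (path S p₀ (fun r => Z r ω) t)} ⊆
        {ω | ENNReal.ofReal (Real.exp (s * b)) ≤
          ENNReal.ofReal (Real.exp (s * σ * h t (path S p₀ (fun r => Z r ω) t)))} ∩
          staysIn S p₀ Z B t := by
      rintro ω ⟨h1, h2⟩
      refine ⟨ENNReal.ofReal_le_ofReal (Real.exp_le_exp.2 ?_), h1⟩
      rw [mul_assoc]
      exact mul_le_mul_of_nonneg_left h2 hs0
    have hsplit : Real.exp (s * |h 0 p₀| + (s * δ + s ^ 2 * K ^ 2) * N - s * b) =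
        Real.exp (-(s * b)) * Real.exp (s * |h 0 p₀| + (s * δ + s ^ 2 * K ^ 2) * N) := by
      rw [← Real.exp_add]; ring_nf
    have hinv : ENNReal.ofReal (Real.exp (-(s * b))) * ENNReal.ofReal (Real.exp (s * b)) = 1 := by
      rw [← ENNReal.ofReal_mul (Real.exp_pos _).le, ← Real.exp_add]; simp
    calc _ ≤ P ({ω | ENNReal.ofReal (Real.exp (s * b)) ≤
          ENNReal.ofReal (Real.exp (s * σ * h t (path S p₀ (fun r => Z r ω) t)))} ∩
          staysIn S p₀ Z B t) := measure_mono hsub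
      _ = P.restrict (staysIn S p₀ Z B t) {ω | ENNReal.ofReal (Real.exp (s * b)) ≤
          ENNReal.ofReal (Real.exp (s * σ * h t (path S p₀ (fun r => Z r ω) t)))} :=
          (Measure.restrict_apply' (measurableSet_staysIn hS hZ hB t)).symm
      _ = ENNReal.ofReal (Real.exp (-(s * b))) * (ENNReal.ofReal (Real.exp (s * b)) *
            P.restrict (staysIn S p₀ Z B t) {ω | ENNReal.ofReal (Real.exp (s * b)) ≤
          ENNReal.ofReal (Real.exp (s * σ * h t (path S p₀ (fun r => Z r ω) t)))}) := by
          rw [← mul_assoc, hinv, one_mul]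
      _ ≤ _ := by
          rw [hsplit, ENNReal.ofReal_mul (Real.exp_pos _).le]
          refine mul_le_mul_right ((hmk.trans hm).trans ?_) _
          refine ENNReal.ofReal_le_ofReal (Real.exp_le_exp.2 ?_)
          rw [habs, mul_pow, ← sq_abs σ, hσ]
          have h1 : s * σ * ρ ^ t * h 0 p₀ ≤ s * |h 0 p₀| := by
            refine (le_abs_self _).trans ?_
            rw [abs_mul, abs_mul, habs, abs_of_nonneg (pow_nonneg hρ t)]
            exact mul_le_mul_of_nonneg_right
              (mul_le_of_le_one_right hs0 (pow_le_one₀ hρ hρ1)) (abs_nonneg _)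
          have h2 : (s * δ + s ^ 2 * 1 ^ 2 * K ^ 2) * ∑ k ∈ Finset.range t, ρ ^ k ≤
              (s * δ + s ^ 2 * K ^ 2) * N := by
            rw [one_pow, mul_one]
            exact mul_le_mul_of_nonneg_left hN (by positivity)
          exact add_le_add h1 h2
  have hcov : staysIn S p₀ Z B t ∩ {ω | b ≤ |h t (path S p₀ (fun r => Z r ω) t)|} ⊆
      (staysIn S p₀ Z B t ∩ {ω | b ≤ 1 * h t (path S p₀ (fun r => Z r ω) t)}) ∪
      (staysIn S p₀ Z B t ∩ {ω | b ≤ -1 * h t (path S p₀ (fun r => Z r ω) t)}) := by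
    rintro ω ⟨h1, h2⟩
    rcases le_abs.1 (show b ≤ |_| from h2) with h3 | h3
    · exact Or.inl ⟨h1, by simpa using h3⟩
    · exact Or.inr ⟨h1, by simpa using h3⟩
  refine (measure_mono hcov).trans ((measure_union_le _ _).trans
    ((add_le_add (one_side 1 (by simp)) (one_side (-1) (by simp))).trans_eq ?_))
  rw [← ENNReal.ofReal_add (Real.exp_pos _).le (Real.exp_pos _).le, two_mul]

end path

/-! ### Means over the data index and the label noise. -/

section sampling
variable {n : ℕ} {Ω : Type*} [MeasurableSpace Ω] {P : Measure Ω} [IsProbabilityMeasure P]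
  {idx : ℕ → Ω → Fin n} {ξ : ℕ → Ω → ℝ}

theorem IsSampling.ne_zero (hS : IsSampling P idx ξ) : n ≠ 0 := by
  rintro rfl
  obtain ⟨ω⟩ := nonempty_of_isProbabilityMeasure P
  exact (idx 0 ω).elim0

omit [IsProbabilityMeasure P] in
theorem IsSampling.exists_bound (hS : IsSampling P idx ξ) :
    ∃ B : ℝ, 1 ≤ B ∧ ∀ᵐ ω ∂P, ∀ t, |ξ t ω| ≤ B := by
  obtain ⟨B, hB⟩ := hS.bounded
  exact ⟨max 1 B, le_max_left _ _,
    ae_all_iff.2 fun t => (hB t).mono fun ω h => h.trans (le_max_right _ _)⟩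

theorem IsSampling.integral_idx (hS : IsSampling P idx ξ) (t : ℕ) (u : Fin n → ℝ) :
    ∫ ω, u (idx t ω) ∂P = avg u := by
  have hm := hS.measurable_idx t
  have hp : IsProbabilityMeasure (P.map (idx t)) := Measure.isProbabilityMeasure_map hm.aemeasurable
  rw [← integral_map (f := u) hm.aemeasurable (by fun_prop), integral_fintype (Integrable.of_finite),
    avg, Finset.mul_sum]
  refine Finset.sum_congr rfl fun i _ => ?_
  rw [measureReal_def, Measure.map_apply hm (measurableSet_singleton i), hS.uniform t i]
  simp

/-- The mean of a quadratic polynomial in the noise with coefficients depending on the index. -/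
theorem IsSampling.integral_quadratic (hS : IsSampling P idx ξ) (t : ℕ) (u v w : Fin n → ℝ) :
    ∫ ω, (u (idx t ω) + v (idx t ω) * ξ t ω + w (idx t ω) * ξ t ω ^ 2) ∂P =
      avg (fun i => u i + w i) := by
  obtain ⟨B, -, hB'⟩ := hS.exists_bound
  have hB : ∀ᵐ ω ∂P, |ξ t ω| ≤ B := hB'.mono fun ω h => h t
  have hidx := hS.measurable_idx t
  have hξ := hS.measurable_noise t
  have hmem : MemLp (ξ t) 2 P := MemLp.of_bound hξ.aestronglyMeasurable B hB
  have hξi : Integrable (ξ t) P := hmem.integrable (by norm_num)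
  have hξ2 : Integrable (fun ω => ξ t ω ^ 2) P := hmem.integrable_sq
  have hfin : ∀ z : Fin n → ℝ, ∀ᵐ ω ∂P, ‖z (idx t ω)‖ ≤ ∑ i, ‖z i‖ := fun z =>
    Eventually.of_forall fun ω => Finset.single_le_sum (f := fun i => ‖z i‖)
      (fun i _ => norm_nonneg _) (Finset.mem_univ _)
  have hmz : ∀ z : Fin n → ℝ, Measurable fun ω => z (idx t ω) := fun z =>
    (measurable_of_finite z).comp hidx
  have hui : ∀ z : Fin n → ℝ, Integrable (fun ω => z (idx t ω)) P := fun z =>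
    Integrable.of_bound (hmz z).aestronglyMeasurable _ (hfin z)
  have hvi : Integrable (fun ω => v (idx t ω) * ξ t ω) P :=
    hξi.bdd_mul (hmz v).aestronglyMeasurable (hfin v)
  have hwi : Integrable (fun ω => w (idx t ω) * ξ t ω ^ 2) P :=
    hξ2.bdd_mul (hmz w).aestronglyMeasurable (hfin w)
  have hsq : ∫ ω, ξ t ω ^ 2 ∂P = 1 := by
    have h1 := variance_eq_sub hmem
    rw [hS.unit_variance t, hS.mean_zero t] at h1
    simpa using h1.symm
  have hiv : ∫ ω, v (idx t ω) * ξ t ω ∂P = 0 := by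
    have hind : IndepFun (fun ω => v (idx t ω)) (ξ t) P :=
      (hS.indep_idx_noise t).comp (measurable_of_finite v) measurable_id
    rw [hind.integral_fun_mul_eq_mul_integral (hmz v).aestronglyMeasurable
      hξ.aestronglyMeasurable, hS.mean_zero t, mul_zero]
  have hiw : ∫ ω, w (idx t ω) * ξ t ω ^ 2 ∂P = avg w := by
    have hind : IndepFun (fun ω => w (idx t ω)) (fun ω => ξ t ω ^ 2) P :=
      (hS.indep_idx_noise t).comp (measurable_of_finite w) (measurable_id.pow_const 2)
    rw [hind.integral_fun_mul_eq_mul_integral (hmz w).aestronglyMeasurable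
      (hξ.pow_const 2).aestronglyMeasurable, hsq, mul_one, hS.integral_idx]
  rw [integral_add (f := fun ω => u (idx t ω) + v (idx t ω) * ξ t ω) ((hui u).add hvi) hwi,
    integral_add (hui u) hvi, hiv, hiw, hS.integral_idx, add_zero, avg_add]

end sampling

/-! ### One step of gradient descent: size and mean of the increments. -/

/-- Quantitative expansion near the origin of residuals `G i` and their gradients `D i`, with
linear parts `a i` and `H i`. The radius is `r`, and `C` is a common constant. -/
structure Expansion {d n : ℕ} (G : Fin n → Param d → ℝ) (D : Fin n → Param d → Param d)
    (a : Fin n → Param d) (H : Fin n → Param d →ₗ[ℝ] Param d) (C r : ℝ) : Prop where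
  one_le : 1 ≤ C
  r_le_one : r ≤ 1
  norm_a_le : ∀ i, ‖a i‖ ≤ C
  norm_H_le : ∀ i p, ‖H i p‖ ≤ C * ‖p‖
  G_le : ∀ i p, ‖p‖ ≤ r → |G i p - inner ℝ (a i) p| ≤ C * ‖p‖ ^ 2
  D_le : ∀ i p, ‖p‖ ≤ r → ‖D i p - a i - H i p‖ ≤ C * ‖p‖ ^ 2

/-- One step of stochastic gradient descent, in terms of the residuals and their gradients. -/
def stepMap {d n : ℕ} (G : Fin n → Param d → ℝ) (D : Fin n → Param d → Param d) (η : ℝ)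
    (p : Param d) (z : Fin n × ℝ) : Param d :=
  p - (2 * η * (G z.1 p - z.2)) • D z.1 p

theorem measurable_stepMap {d n : ℕ} {G : Fin n → Param d → ℝ} {D : Fin n → Param d → Param d}
    (hG : ∀ i, Measurable (G i)) (hD : ∀ i, Measurable (D i)) (η : ℝ) :
    Measurable (Function.uncurry (stepMap G D η)) := by
  have h1 : Measurable fun q : Fin n × (Param d × ℝ) =>
      q.2.1 - (2 * η * (G q.1 q.2.1 - q.2.2)) • D q.1 q.2.1 := by
    refine measurable_from_prod_countable_right fun i => ?_
    have hG' := hG i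
    have hD' := hD i
    exact measurable_fst.sub ((((hG'.comp measurable_fst).sub measurable_snd).const_mul _).smul
      (hD'.comp measurable_fst))
  exact h1.comp (f := fun q : Param d × (Fin n × ℝ) => (q.2.1, (q.1, q.2.2))) (by fun_prop)

namespace Expansion
variable {d n : ℕ} {G : Fin n → Param d → ℝ} {D : Fin n → Param d → Param d}
  {a : Fin n → Param d} {H : Fin n → Param d →ₗ[ℝ] Param d} {C r : ℝ}

theorem nonneg (h : Expansion G D a H C r) : 0 ≤ C := zero_le_one.trans h.one_le

theorem norm_sq_le (h : Expansion G D a H C r) {p : Param d} (hp : ‖p‖ ≤ r) : ‖p‖ ^ 2 ≤ ‖p‖ := by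
  have h0 := norm_nonneg p
  have h1 := hp.trans h.r_le_one
  nlinarith

theorem abs_inner_a_le (h : Expansion G D a H C r) (i : Fin n) (p : Param d) :
    |inner ℝ (a i) p| ≤ C * ‖p‖ :=
  (abs_real_inner_le_norm _ _).trans (mul_le_mul_of_nonneg_right (h.norm_a_le i) (norm_nonneg p))

theorem abs_G_le (h : Expansion G D a H C r) (i : Fin n) {p : Param d} (hp : ‖p‖ ≤ r) :
    |G i p| ≤ 2 * C * ‖p‖ := by
  have h1 := h.G_le i p hp
  have h2 := h.abs_inner_a_le i p
  have h3 := mul_le_mul_of_nonneg_left (h.norm_sq_le hp) h.nonneg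
  calc |G i p| = |(G i p - inner ℝ (a i) p) + inner ℝ (a i) p| := by ring_nf
    _ ≤ _ := (abs_add_le _ _).trans (by linarith)

theorem norm_D_sub_le (h : Expansion G D a H C r) (i : Fin n) {p : Param d} (hp : ‖p‖ ≤ r) :
    ‖D i p - a i‖ ≤ 2 * C * ‖p‖ := by
  have h1 := h.D_le i p hp
  have h2 := h.norm_H_le i p
  have h3 := mul_le_mul_of_nonneg_left (h.norm_sq_le hp) h.nonneg
  calc ‖D i p - a i‖ = ‖(D i p - a i - H i p) + H i p‖ := by congr 1; abel
    _ ≤ _ := (norm_add_le _ _).trans (by linarith)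

theorem norm_D_le (h : Expansion G D a H C r) (i : Fin n) {p : Param d} (hp : ‖p‖ ≤ r) :
    ‖D i p‖ ≤ 3 * C := by
  have h1 := h.norm_D_sub_le i hp
  have h2 := h.norm_a_le i
  have h3 := mul_le_mul_of_nonneg_left (hp.trans h.r_le_one) h.nonneg
  calc ‖D i p‖ = ‖(D i p - a i) + a i‖ := by congr 1; abel
    _ ≤ _ := (norm_add_le _ _).trans (by linarith)

/-- Replacing the factors one at a time leaves either a quadratic error times a bounded factor, or a
linear factor times a linear error. -/
theorem norm_G_smul_D_sub_le (h : Expansion G D a H C r) (i : Fin n) {p : Param d}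
    (hp : ‖p‖ ≤ r) : ‖G i p • D i p - inner ℝ (a i) p • a i‖ ≤ 5 * C ^ 2 * ‖p‖ ^ 2 := by
  have h0 := h.nonneg
  calc ‖G i p • D i p - inner ℝ (a i) p • a i‖
      = ‖(G i p - inner ℝ (a i) p) • D i p + inner ℝ (a i) p • (D i p - a i)‖ := by
        congr 1; rw [sub_smul, smul_sub]; abel
    _ ≤ |G i p - inner ℝ (a i) p| * ‖D i p‖ + |inner ℝ (a i) p| * ‖D i p - a i‖ := by
        refine (norm_add_le _ _).trans_eq ?_
        rw [norm_smul, norm_smul, Real.norm_eq_abs, Real.norm_eq_abs]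
    _ ≤ C * ‖p‖ ^ 2 * (3 * C) + C * ‖p‖ * (2 * C * ‖p‖) := by
        gcongr
        exacts [h.G_le i p hp, h.norm_D_le i hp, h.abs_inner_a_le i p, h.norm_D_sub_le i hp]
    _ = _ := by ring

theorem abs_residual_le (h : Expansion G D a H C r) (i : Fin n) {p : Param d} (hp : ‖p‖ ≤ r)
    {x : ℝ} (hx : |x| ≤ C) : |G i p - x| ≤ 3 * C := by
  have h1 := h.abs_G_le i hp
  have h3 := mul_le_mul_of_nonneg_left (hp.trans h.r_le_one) h.nonneg
  exact (abs_sub _ _).trans (by linarith)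

theorem norm_stepMap_sub_le (h : Expansion G D a H C r) {η : ℝ} (hη : 0 ≤ η) {p : Param d}
    (hp : ‖p‖ ≤ r) {z : Fin n × ℝ} (hz : |z.2| ≤ C) : ‖stepMap G D η p z - p‖ ≤ 18 * C ^ 2 * η := by
  have h0 := h.nonneg
  calc ‖stepMap G D η p z - p‖ = 2 * η * |G z.1 p - z.2| * ‖D z.1 p‖ := by
        rw [stepMap, sub_sub_cancel_left, norm_neg, norm_smul, Real.norm_eq_abs, abs_mul, abs_mul,
          abs_two, abs_of_nonneg hη]
    _ ≤ 2 * η * (3 * C) * (3 * C) := by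
        gcongr
        exacts [h.abs_residual_le _ hp hz, h.norm_D_le _ hp]
    _ = _ := by ring

section stable
variable {e : Param d} {l : ℝ}

theorem eigenvalue_le (h : Expansion G D a H C r) (hn : n ≠ 0) (he : ‖e‖ = 1)
    (hl : ∀ p, avg (fun i => inner ℝ (a i) p * inner ℝ e (a i)) = l * inner ℝ e p) : l ≤ C ^ 2 := by
  have h0 := h.nonneg
  have h1 := hl e
  rw [real_inner_self_eq_norm_sq, he, one_pow, mul_one] at h1
  rw [← h1]
  refine (le_abs_self _).trans (abs_avg_le hn fun i => ?_)
  have h2 := h.abs_inner_a_le i e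
  rw [he, mul_one] at h2
  rw [real_inner_comm, abs_mul, sq, real_inner_comm]
  gcongr

/-- Both the step and the contraction term are `O(η)`. This crude size is enough, because
contraction limits the noise memory to about `1/η` steps. -/
theorem stable_bound (h : Expansion G D a H C r) (hn : n ≠ 0) (he : ‖e‖ = 1)
    (hl : ∀ p, avg (fun i => inner ℝ (a i) p * inner ℝ e (a i)) = l * inner ℝ e p) (hl0 : 0 ≤ l)
    {η : ℝ} (hη : 0 ≤ η) {p : Param d} (hp : ‖p‖ ≤ r) {z : Fin n × ℝ} (hz : |z.2| ≤ C) :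
    |inner ℝ e (stepMap G D η p z) - (1 - 2 * η * l) * inner ℝ e p| ≤ 20 * C ^ 2 * η := by
  have h1 : |inner ℝ e (stepMap G D η p z - p)| ≤ 18 * C ^ 2 * η := by
    refine (abs_real_inner_le_norm _ _).trans ?_
    rw [he, one_mul]; exact h.norm_stepMap_sub_le hη hp hz
  have h2 : |inner ℝ e p| ≤ 1 := by
    refine (abs_real_inner_le_norm _ _).trans ?_
    rw [he, one_mul]; exact hp.trans h.r_le_one
  have h3 : |2 * η * l * inner ℝ e p| ≤ 2 * η * C ^ 2 := by
    rw [abs_mul, abs_of_nonneg (by positivity : 0 ≤ 2 * η * l)]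
    calc 2 * η * l * |inner ℝ e p| ≤ 2 * η * C ^ 2 * 1 := by
          gcongr; exact h.eigenvalue_le hn he hl
      _ = _ := mul_one _
  have h4 : inner ℝ e (stepMap G D η p z) - (1 - 2 * η * l) * inner ℝ e p =
      inner ℝ e (stepMap G D η p z - p) + 2 * η * l * inner ℝ e p := by
    rw [inner_sub_right]; ring
  rw [h4]
  exact (abs_add_le _ _).trans (by linarith)

variable {Ω : Type*} [MeasurableSpace Ω] {P : Measure Ω} [IsProbabilityMeasure P]
  {idx : ℕ → Ω → Fin n} {ξ : ℕ → Ω → ℝ}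

/-- The mean of the linear part is exactly the contraction by `1 - 2 * η * l`, and the label noise
averages out; only the quadratic remainder of residual times gradient is left. -/
theorem stable_mean (h : Expansion G D a H C r) (hS : IsSampling P idx ξ) (he : ‖e‖ = 1)
    (hl : ∀ p, avg (fun i => inner ℝ (a i) p * inner ℝ e (a i)) = l * inner ℝ e p)
    {η : ℝ} (hη : 0 ≤ η) {p : Param d} (hp : ‖p‖ ≤ r) (t : ℕ) :
    |∫ ω, (inner ℝ e (stepMap G D η p (idx t ω, ξ t ω)) - (1 - 2 * η * l) * inner ℝ e p) ∂P| ≤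
      10 * C ^ 2 * η * ‖p‖ ^ 2 := by
  have hn := hS.ne_zero
  have h1 : ∀ ω, inner ℝ e (stepMap G D η p (idx t ω, ξ t ω)) - (1 - 2 * η * l) * inner ℝ e p =
      (2 * η * l * inner ℝ e p - 2 * η * (G (idx t ω) p * inner ℝ e (D (idx t ω) p))) +
        (2 * η * inner ℝ e (D (idx t ω) p)) * ξ t ω + 0 * ξ t ω ^ 2 := by
    intro ω
    simp only [stepMap, inner_sub_right, inner_smul_right]; ring
  simp only [h1]
  rw [hS.integral_quadratic t
    (fun i => 2 * η * l * inner ℝ e p - 2 * η * (G i p * inner ℝ e (D i p)))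
    (fun i => 2 * η * inner ℝ e (D i p)) (fun _ => 0)]
  have h2 : avg (fun i => 2 * η * l * inner ℝ e p - 2 * η * (G i p * inner ℝ e (D i p)) + 0) =
      -(2 * η) * avg (fun i => inner ℝ e (G i p • D i p - inner ℝ (a i) p • a i)) := by
    simp only [add_zero, inner_sub_right, inner_smul_right, avg_sub, avg_const hn, avg_const_mul, hl]
    ring
  rw [h2, abs_mul, abs_neg, abs_of_nonneg (by positivity : 0 ≤ 2 * η)]
  have h3 : |avg (fun i => inner ℝ e (G i p • D i p - inner ℝ (a i) p • a i))| ≤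
      5 * C ^ 2 * ‖p‖ ^ 2 := by
    refine abs_avg_le hn fun i => (abs_real_inner_le_norm _ _).trans ?_
    rw [he, one_mul]; exact h.norm_G_smul_D_sub_le i hp
  calc _ ≤ 2 * η * (5 * C ^ 2 * ‖p‖ ^ 2) := by gcongr
    _ = _ := by ring

end stable

section flat
variable {e : Param d} {γ : LinearMap.BilinForm ℝ (Param d)} {w : ℝ}

theorem abs_inner_D_le (h : Expansion G D a H C r) (he : ‖e‖ = 1) (hea : ∀ i, inner ℝ e (a i) = 0)
    (i : Fin n) {p : Param d} (hp : ‖p‖ ≤ r) : |inner ℝ e (D i p)| ≤ 2 * C * ‖p‖ := by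
  have h1 : inner ℝ e (D i p) = inner ℝ e (D i p - a i) := by rw [inner_sub_right, hea, sub_zero]
  rw [h1]
  refine (abs_real_inner_le_norm _ _).trans ?_
  rw [he, one_mul]; exact h.norm_D_sub_le i hp

/-- Orthogonality of `e` to the `a i` leaves a motion of size `η‖p‖` in this coordinate. The
corrector changes by `2γ(p, v) + γ(v, v)` with `v` of size `η`, hence the additional `η²`. -/
theorem flat_bound (h : Expansion G D a H C r) (he : ‖e‖ = 1) (hea : ∀ i, inner ℝ e (a i) = 0)
    (hγs : ∀ p q, γ p q = γ q p) (hγ : ∀ p q, |γ p q| ≤ C * ‖p‖ * ‖q‖) (hw : |w| ≤ 2 * C ^ 2)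
    {η : ℝ} (hη : 0 ≤ η) {p : Param d} (hp : ‖p‖ ≤ r) {z : Fin n × ℝ} (hz : |z.2| ≤ C) :
    |(inner ℝ e (stepMap G D η p z) - γ (stepMap G D η p z) (stepMap G D η p z)) -
      (inner ℝ e p - γ p p) + η ^ 2 * w| ≤ 400 * C ^ 5 * (η * ‖p‖ + η ^ 2) := by
  have h0 := h.nonneg
  have h1C := h.one_le
  obtain ⟨v, hv⟩ : ∃ v, v = stepMap G D η p z - p := ⟨_, rfl⟩
  have hstep : stepMap G D η p z = p + v := by rw [hv]; abel
  have hvn : ‖v‖ ≤ 18 * C ^ 2 * η := hv ▸ h.norm_stepMap_sub_le hη hp hz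
  have hev : |inner ℝ e v| ≤ 12 * C ^ 2 * η * ‖p‖ := by
    have : inner ℝ e v = -(2 * η * (G z.1 p - z.2) * inner ℝ e (D z.1 p)) := by
      rw [hv, stepMap, sub_sub_cancel_left, inner_neg_right, inner_smul_right]
    rw [this, abs_neg, abs_mul, abs_mul, abs_of_nonneg (by positivity : 0 ≤ 2 * η)]
    calc _ ≤ 2 * η * (3 * C) * (2 * C * ‖p‖) := by
          gcongr
          exacts [h.abs_residual_le _ hp hz, h.abs_inner_D_le he hea _ hp]
      _ = _ := by ring
  have hpv : |2 * γ p v| ≤ 36 * C ^ 3 * η * ‖p‖ := by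
    rw [abs_mul, abs_two]
    calc 2 * |γ p v| ≤ 2 * (C * ‖p‖ * ‖v‖) := by gcongr; exact hγ p v
      _ ≤ 2 * (C * ‖p‖ * (18 * C ^ 2 * η)) := by gcongr
      _ = _ := by ring
  have hvv : |γ v v| ≤ 324 * C ^ 5 * η ^ 2 := by
    calc |γ v v| ≤ C * ‖v‖ * ‖v‖ := hγ v v
      _ ≤ C * (18 * C ^ 2 * η) * (18 * C ^ 2 * η) := by gcongr
      _ = _ := by ring
  have hww : |η ^ 2 * w| ≤ 2 * C ^ 2 * η ^ 2 := by
    rw [abs_mul, abs_of_nonneg (sq_nonneg η)]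
    calc η ^ 2 * |w| ≤ η ^ 2 * (2 * C ^ 2) := by gcongr
      _ = _ := by ring
  have heq : (inner ℝ e (p + v) - γ (p + v) (p + v)) - (inner ℝ e p - γ p p) + η ^ 2 * w =
      inner ℝ e v + -(2 * γ p v) + -γ v v + η ^ 2 * w := by
    simp only [inner_add_right, map_add, LinearMap.add_apply, hγs v p]; ring
  have hC2 : C ^ 2 ≤ C ^ 5 := pow_le_pow_right₀ h1C (by norm_num)
  have hC3 : C ^ 3 ≤ C ^ 5 := pow_le_pow_right₀ h1C (by norm_num)
  have hηp : 0 ≤ η * ‖p‖ := by positivity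
  rw [hstep, heq]
  have key : |inner ℝ e v + -(2 * γ p v) + -γ v v + η ^ 2 * w| ≤
      |inner ℝ e v| + |2 * γ p v| + |γ v v| + |η ^ 2 * w| := by
    have := abs_add_le (inner ℝ e v + -(2 * γ p v) + -γ v v) (η ^ 2 * w)
    have := abs_add_le (inner ℝ e v + -(2 * γ p v)) (-γ v v)
    have := abs_add_le (inner ℝ e v) (-(2 * γ p v))
    rw [abs_neg] at *
    linarith
  have := mul_le_mul_of_nonneg_right hC2 hηp
  have := mul_le_mul_of_nonneg_right hC3 hηp
  have := mul_le_mul_of_nonneg_right hC2 (sq_nonneg η)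
  have : 0 ≤ C ^ 5 * (η * ‖p‖) := by positivity
  have : 0 ≤ C ^ 5 * η ^ 2 := by positivity
  linarith

variable {Ω : Type*} [MeasurableSpace Ω] {P : Measure Ω} [IsProbabilityMeasure P]
  {idx : ℕ → Ω → Fin n} {ξ : ℕ → Ω → ℝ}

/-- The central cancellation. The corrector's cross term removes the quadratic drift of order
`η‖p‖²` by the Lyapunov equation, and the noise variance in `γ(v, v)` produces the constant drift
`-η² w`; only errors of higher order in `p` remain. -/
theorem flat_mean (h : Expansion G D a H C r) (hS : IsSampling P idx ξ) (he : ‖e‖ = 1)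
    (hea : ∀ i, inner ℝ e (a i) = 0) (hγs : ∀ p q, γ p q = γ q p)
    (hγ : ∀ p q, |γ p q| ≤ C * ‖p‖ * ‖q‖)
    (hγ1 : ∀ p, 2 * avg (fun i => inner ℝ (a i) p * γ p (a i)) =
      avg (fun i => inner ℝ (a i) p * inner ℝ e (H i p)))
    (hγ2 : 4 * avg (fun i => γ (a i) (a i)) = w)
    {η : ℝ} (hη : 0 ≤ η) {p : Param d} (hp : ‖p‖ ≤ r) (t : ℕ) :
    |∫ ω, ((inner ℝ e (stepMap G D η p (idx t ω, ξ t ω)) -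
        γ (stepMap G D η p (idx t ω, ξ t ω)) (stepMap G D η p (idx t ω, ξ t ω))) -
      (inner ℝ e p - γ p p) + η ^ 2 * w) ∂P| ≤
      200 * C ^ 5 * (η * ‖p‖ ^ 3 + η ^ 2 * ‖p‖) := by
  have hn := hS.ne_zero
  have h0 := h.nonneg
  have h1C := h.one_le
  -- Coefficients of the powers of the noise; only the zeroth and second contribute to the mean.
  let U : Fin n → ℝ := fun i => -(2 * η * G i p) * inner ℝ e (D i p) +
    4 * η * G i p * γ p (D i p) - 4 * η ^ 2 * G i p ^ 2 * γ (D i p) (D i p) + η ^ 2 * w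
  let V : Fin n → ℝ := fun i => 2 * η * inner ℝ e (D i p) - 4 * η * γ p (D i p) +
    8 * η ^ 2 * G i p * γ (D i p) (D i p)
  let W : Fin n → ℝ := fun i => -(4 * η ^ 2) * γ (D i p) (D i p)
  have h1 : ∀ ω, (inner ℝ e (stepMap G D η p (idx t ω, ξ t ω)) -
        γ (stepMap G D η p (idx t ω, ξ t ω)) (stepMap G D η p (idx t ω, ξ t ω))) -
      (inner ℝ e p - γ p p) + η ^ 2 * w =
      U (idx t ω) + V (idx t ω) * ξ t ω + W (idx t ω) * ξ t ω ^ 2 := by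
    intro ω
    simp only [stepMap, inner_sub_right, inner_smul_right, map_sub, map_smul, LinearMap.sub_apply,
      LinearMap.smul_apply, smul_eq_mul, U, V, W, hγs (D (idx t ω) p) p]
    ring
  simp only [h1]
  rw [hS.integral_quadratic t U V W]
  -- Remainders of the three contributions (flat coordinate, cross term of the corrector, its
  -- second-order term) after subtracting their leading parts. The factor `1 + G i p ^ 2` in `Q` is
  -- the mean of `(G i p - ξ)²`.
  let X : Fin n → ℝ := fun i => G i p * inner ℝ e (D i p) - inner ℝ (a i) p * inner ℝ e (H i p)
  let Y : Fin n → ℝ := fun i => γ p (G i p • D i p - inner ℝ (a i) p • a i)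
  let Q : Fin n → ℝ := fun i => (1 + G i p ^ 2) * γ (D i p) (D i p) - γ (a i) (a i)
  have hX : |avg X| ≤ 3 * C ^ 2 * ‖p‖ ^ 3 := by
    refine abs_avg_le hn fun i => ?_
    have heq : X i = (G i p - inner ℝ (a i) p) * inner ℝ e (D i p) +
        inner ℝ (a i) p * inner ℝ e (D i p - a i - H i p) := by
      simp only [X, inner_sub_right, hea]; ring
    have h3 : |inner ℝ e (D i p - a i - H i p)| ≤ C * ‖p‖ ^ 2 := by
      refine (abs_real_inner_le_norm _ _).trans ?_
      rw [he, one_mul]; exact h.D_le i p hp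
    rw [heq]
    refine (abs_add_le _ _).trans ?_
    rw [abs_mul, abs_mul]
    calc _ ≤ C * ‖p‖ ^ 2 * (2 * C * ‖p‖) + C * ‖p‖ * (C * ‖p‖ ^ 2) := by
          gcongr
          exacts [h.G_le i p hp, h.abs_inner_D_le he hea i hp, h.abs_inner_a_le i p]
      _ = _ := by ring
  have hY : |avg Y| ≤ 5 * C ^ 3 * ‖p‖ ^ 3 := by
    refine abs_avg_le hn fun i => (hγ _ _).trans ?_
    calc _ ≤ C * ‖p‖ * (5 * C ^ 2 * ‖p‖ ^ 2) := by
          gcongr; exact h.norm_G_smul_D_sub_le i hp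
      _ = _ := by ring
  have hQ : |avg Q| ≤ 44 * C ^ 5 * ‖p‖ := by
    refine abs_avg_le hn fun i => ?_
    have heq : Q i = γ (D i p - a i) (D i p) + γ (a i) (D i p - a i) +
        G i p ^ 2 * γ (D i p) (D i p) := by
      simp only [Q, map_sub, LinearMap.sub_apply]; ring
    have h3 : |γ (D i p - a i) (D i p)| ≤ 6 * C ^ 3 * ‖p‖ := by
      refine (hγ _ _).trans ?_
      calc _ ≤ C * (2 * C * ‖p‖) * (3 * C) := by
            gcongr
            exacts [h.norm_D_sub_le i hp, h.norm_D_le i hp]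
        _ = _ := by ring
    have h4 : |γ (a i) (D i p - a i)| ≤ 2 * C ^ 3 * ‖p‖ := by
      refine (hγ _ _).trans ?_
      calc _ ≤ C * C * (2 * C * ‖p‖) := by
            gcongr
            exacts [h.norm_a_le i, h.norm_D_sub_le i hp]
        _ = _ := by ring
    have h5 : |G i p ^ 2 * γ (D i p) (D i p)| ≤ 36 * C ^ 5 * ‖p‖ := by
      rw [abs_mul, abs_pow]
      calc _ ≤ (2 * C * ‖p‖) ^ 2 * (C * (3 * C) * (3 * C)) := by
            gcongr
            · exact h.abs_G_le i hp
            · refine (hγ _ _).trans ?_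
              gcongr <;> exact h.norm_D_le i hp
        _ = 36 * C ^ 5 * ‖p‖ ^ 2 := by ring
        _ ≤ _ := by gcongr; exact h.norm_sq_le hp
    have hC3 : C ^ 3 * ‖p‖ ≤ C ^ 5 * ‖p‖ :=
      mul_le_mul_of_nonneg_right (pow_le_pow_right₀ h1C (by norm_num)) (norm_nonneg p)
    rw [heq]
    have := abs_add_le (γ (D i p - a i) (D i p) + γ (a i) (D i p - a i))
      (G i p ^ 2 * γ (D i p) (D i p))
    have := abs_add_le (γ (D i p - a i) (D i p)) (γ (a i) (D i p - a i))
    linarith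
  -- The subtracted leading parts cancel: those of order `η` by `hγ1`, those of order `η²` by `hγ2`.
  have hsum : avg (fun i => U i + W i) =
      -(2 * η) * avg X + 4 * η * avg Y + -(4 * η ^ 2) * avg Q := by
    have hUW : ∀ i, U i + W i = -(2 * η) * X i + 4 * η * Y i + -(4 * η ^ 2) * Q i +
        (-(2 * η) * (inner ℝ (a i) p * inner ℝ e (H i p)) +
          4 * η * (inner ℝ (a i) p * γ p (a i)) + -(4 * η ^ 2) * γ (a i) (a i) + η ^ 2 * w) := by
      intro i
      simp only [U, W, X, Y, Q, map_sub, map_smul, smul_eq_mul]; ring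
    simp only [hUW]
    simp only [avg_add, avg_const_mul, avg_const hn, ← hγ1, ← hγ2]
    ring
  rw [hsum]
  have hC2 : C ^ 2 * (η * ‖p‖ ^ 3) ≤ C ^ 5 * (η * ‖p‖ ^ 3) :=
    mul_le_mul_of_nonneg_right (pow_le_pow_right₀ h1C (by norm_num)) (by positivity)
  have hC3 : C ^ 3 * (η * ‖p‖ ^ 3) ≤ C ^ 5 * (η * ‖p‖ ^ 3) :=
    mul_le_mul_of_nonneg_right (pow_le_pow_right₀ h1C (by norm_num)) (by positivity)
  have b1 : |-(2 * η) * avg X| ≤ 6 * (C ^ 2 * (η * ‖p‖ ^ 3)) := by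
    rw [abs_mul, abs_neg, abs_of_nonneg (by positivity : 0 ≤ 2 * η)]
    calc _ ≤ 2 * η * (3 * C ^ 2 * ‖p‖ ^ 3) := by gcongr
      _ = _ := by ring
  have b2 : |4 * η * avg Y| ≤ 20 * (C ^ 3 * (η * ‖p‖ ^ 3)) := by
    rw [abs_mul, abs_of_nonneg (by positivity : 0 ≤ 4 * η)]
    calc _ ≤ 4 * η * (5 * C ^ 3 * ‖p‖ ^ 3) := by gcongr
      _ = _ := by ring
  have b3 : |-(4 * η ^ 2) * avg Q| ≤ 176 * (C ^ 5 * (η ^ 2 * ‖p‖)) := by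
    rw [abs_mul, abs_neg, abs_of_nonneg (by positivity : 0 ≤ 4 * η ^ 2)]
    calc _ ≤ 4 * η ^ 2 * (44 * C ^ 5 * ‖p‖) := by gcongr
      _ = _ := by ring
  have := abs_add_le (-(2 * η) * avg X + 4 * η * avg Y) (-(4 * η ^ 2) * avg Q)
  have := abs_add_le (-(2 * η) * avg X) (4 * η * avg Y)
  have : 0 ≤ C ^ 5 * (η * ‖p‖ ^ 3) := by positivity
  have : 0 ≤ C ^ 5 * (η ^ 2 * ‖p‖) := by positivity
  linarith

end flat
end Expansion

/-! ### Tail bounds on the scales `η = x ^ 100`. -/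

/-- An eigenbasis `e` of the second moment matrix of the vectors `a i`, with eigenvalues `l`, and
for each of its vectors a quadratic corrector `γ j` that solves the Lyapunov equation. -/
structure Correctors {d n : ℕ} (a : Fin n → Param d) (H : Fin n → Param d →ₗ[ℝ] Param d) (C : ℝ)
    (e : OrthonormalBasis (Fin d) ℝ (Param d)) (l : Fin d → ℝ)
    (γ : Fin d → LinearMap.BilinForm ℝ (Param d)) (w : Fin d → ℝ) : Prop where
  nonneg : ∀ j, 0 ≤ l j
  eigen : ∀ j p, avg (fun i => inner ℝ (a i) p * inner ℝ (e j) (a i)) = l j * inner ℝ (e j) p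
  symm : ∀ j p q, γ j p q = γ j q p
  le : ∀ j p q, |γ j p q| ≤ C * ‖p‖ * ‖q‖
  lyapunov : ∀ j p, 2 * avg (fun i => inner ℝ (a i) p * γ j p (a i)) =
    avg (fun i => inner ℝ (a i) p * inner ℝ (e j) (H i p))
  trace : ∀ j, 4 * avg (fun i => γ j (a i) (a i)) = w j
  w_le : ∀ j, |w j| ≤ 2 * C ^ 2

theorem eventually_small (c : ℝ) : ∀ᶠ x : ℝ in 𝓝[>] 0, 0 < x ∧ x ≤ 1 ∧ c * x ≤ 1 := by
  have h1 : Tendsto (fun x : ℝ => c * x) (𝓝[>] 0) (𝓝 0) := by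
    have : Tendsto (fun x : ℝ => c * x) (𝓝 0) (𝓝 (c * 0)) := tendsto_id.const_mul c
    rw [mul_zero] at this
    exact this.mono_left nhdsWithin_le_nhds
  have h2 : ∀ᶠ x : ℝ in 𝓝[>] 0, x ≤ 1 :=
    nhdsWithin_le_nhds (eventually_le_nhds zero_lt_one)
  filter_upwards [self_mem_nhdsWithin, h2, h1.eventually (eventually_le_nhds zero_lt_one)]
    with x hx hx1 hx2 using ⟨hx, hx1, hx2⟩

/-- Lowering the exponent from `4` to `3` pays for a union bound over about `x ^ (-160)` times. -/
theorem eventually_mul_exp_le (c : ℝ) : ∀ᶠ x : ℝ in 𝓝[>] 0,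
    ((x⁻¹) ^ 160 + 1) * (c * Real.exp (-(x⁻¹) ^ 4)) ≤ Real.exp (-(x⁻¹) ^ 3) := by
  have h1 : ∀ᶠ y : ℝ in atTop, (y ^ 160 + 1) * (c * Real.exp (-y ^ 4)) ≤ Real.exp (-y ^ 3) := by
    have h2 : Tendsto (fun y : ℝ => |c| * (y ^ 160 * Real.exp (-y) + y ^ 0 * Real.exp (-y))) atTop
        (𝓝 (|c| * (0 + 0))) :=
      ((Real.tendsto_pow_mul_exp_neg_atTop_nhds_zero 160).add
        (Real.tendsto_pow_mul_exp_neg_atTop_nhds_zero 0)).const_mul _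
    rw [add_zero, mul_zero] at h2
    filter_upwards [h2.eventually (eventually_le_nhds zero_lt_one), eventually_ge_atTop 2]
      with y hy hy2
    have h3 : Real.exp (-y ^ 4) ≤ Real.exp (-y) * Real.exp (-y ^ 3) := by
      rw [← Real.exp_add, Real.exp_le_exp]
      have h4 : 0 ≤ y ^ 3 * (y - 2) := by have := sub_nonneg.2 hy2; positivity
      have h5 : y * 1 ≤ y * y ^ 2 := by gcongr; nlinarith
      nlinarith
    calc (y ^ 160 + 1) * (c * Real.exp (-y ^ 4))
        ≤ (y ^ 160 + 1) * (|c| * (Real.exp (-y) * Real.exp (-y ^ 3))) := by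
          gcongr
          exact le_abs_self c
      _ = (|c| * (y ^ 160 * Real.exp (-y) + y ^ 0 * Real.exp (-y))) * Real.exp (-y ^ 3) := by ring
      _ ≤ 1 * Real.exp (-y ^ 3) := by gcongr
      _ = _ := one_mul _
  exact tendsto_inv_nhdsGT_zero.eventually h1

theorem norm_le_of_abs_inner_le {d : ℕ} (e : OrthonormalBasis (Fin d) ℝ (Param d)) {p : Param d}
    {c : ℝ} (h : ∀ j, |inner ℝ (e j) p| ≤ c) : ‖p‖ ≤ d * c := by
  calc ‖p‖ = ‖∑ j, inner ℝ (e j) p • e j‖ := by rw [e.sum_repr' p]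
    _ ≤ ∑ j, ‖inner ℝ (e j) p • e j‖ := norm_sum_le _ _
    _ ≤ ∑ _j : Fin d, c := Finset.sum_le_sum fun j _ => by
        rw [norm_smul, e.norm_eq_one, mul_one]; exact h j
    _ = _ := by simp

section
variable {d n : ℕ} {G : Fin n → Param d → ℝ} {D : Fin n → Param d → Param d}
  {a : Fin n → Param d} {H : Fin n → Param d →ₗ[ℝ] Param d} {C r : ℝ}
  {e : OrthonormalBasis (Fin d) ℝ (Param d)} {l : Fin d → ℝ}
  {γ : Fin d → LinearMap.BilinForm ℝ (Param d)} {w : Fin d → ℝ}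
  {Ω : Type*} [MeasurableSpace Ω] {P : Measure Ω} [IsProbabilityMeasure P]
  {idx : ℕ → Ω → Fin n} {ξ : ℕ → Ω → ℝ}

/-- The path of gradient descent with learning rate `η` for residuals `G` with gradients `D`. -/
abbrev sgdPath (G : Fin n → Param d → ℝ) (D : Fin n → Param d → Param d) (η : ℝ) (p₀ : Param d)
    (idx : ℕ → Ω → Fin n) (ξ : ℕ → Ω → ℝ) (ω : Ω) (t : ℕ) : Param d :=
  path (stepMap G D η) p₀ (fun s => (idx s ω, ξ s ω)) t

/-- In a flat direction, the coordinate is corrected by a quadratic form and by its drift. -/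
noncomputable def observable (e : OrthonormalBasis (Fin d) ℝ (Param d)) (l : Fin d → ℝ)
    (γ : Fin d → LinearMap.BilinForm ℝ (Param d)) (w : Fin d → ℝ) (η : ℝ) (j : Fin d) (t : ℕ)
    (p : Param d) : ℝ :=
  if l j = 0 then inner ℝ (e j) p - γ j p p + t * (η ^ 2 * w j) else inner ℝ (e j) p

theorem measurable_observable (η : ℝ) (j : Fin d) (t : ℕ) :
    Measurable (observable e l γ w η j t) := by
  unfold observable
  have h1 : Continuous fun p => inner ℝ (e j) p := by fun_prop
  have h2 : Continuous fun p => γ j p p := by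
    let g : Param d →L[ℝ] Param d →L[ℝ] ℝ :=
      LinearMap.toContinuousLinearMap
        ((LinearMap.toContinuousLinearMap (𝕜 := ℝ) (E := Param d) (F' := ℝ)).toLinearMap ∘ₗ γ j)
    have : ∀ p, γ j p p = g p p := fun p => rfl
    simp only [this]
    fun_prop
  split_ifs
  · exact ((h1.sub h2).add continuous_const).measurable
  · exact h1.measurable

/-- With the exponential parameter `s = x ^ (-50)` used below, the starting value contributes only a
bounded amount to the exponent. -/
theorem abs_observable_zero_le (hc : Correctors a H C e l γ w) (hC : 1 ≤ C) {x : ℝ} (hx : 0 < x)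
    (hx1 : x ≤ 1) {p : Param d} (hp : ‖p‖ ≤ x ^ 50) (η : ℝ) (j : Fin d) :
    |observable e l γ w η j 0 p| ≤ 2 * C * x ^ 50 := by
  have h1 : |inner ℝ (e j) p| ≤ x ^ 50 := by
    refine (abs_real_inner_le_norm _ _).trans ?_
    rw [e.norm_eq_one, one_mul]; exact hp
  have hx50 : 0 < x ^ 50 := by positivity
  unfold observable
  split_ifs
  · have h2 : |γ j p p| ≤ C * x ^ 50 := by
      have hp1 : ‖p‖ ≤ 1 := hp.trans (pow_le_one₀ hx.le hx1)
      calc _ ≤ C * ‖p‖ * ‖p‖ := hc.le j p p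
        _ ≤ C * x ^ 50 * 1 := by gcongr
        _ = _ := mul_one _
    simp only [Nat.cast_zero, zero_mul, add_zero]
    refine (abs_sub _ _).trans ?_
    nlinarith
  · nlinarith

/-- Here there is no contraction, so errors accumulate over all `x ^ (-160)` steps. With `‖p‖ ≤ x ^
39` the increments are of order `x ^ 139` and their means of order `x ^ 217`; after weighting by `s
= x ^ (-50)`, the accumulated bias is of order `x ^ 7` and the variance term of order `x ^ 18`. The
threshold `x ^ 46` contributes `-x ^ (-4)` to the exponent. -/
theorem Expansion.tail_bound_flat (h : Expansion G D a H C r) (hr : 0 < r)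
    (hc : Correctors a H C e l γ w) (hG : ∀ i, Measurable (G i)) (hD : ∀ i, Measurable (D i))
    (hS : IsSampling P idx ξ) (hB : ∀ᵐ ω ∂P, ∀ t, |ξ t ω| ≤ C) {j : Fin d} (hj : l j = 0) :
    ∃ c : ℝ, ∀ᶠ x in 𝓝[>] (0 : ℝ), ∀ p₀ : Param d, ‖p₀‖ ≤ x ^ 50 → ∀ t : ℕ, t * x ^ 160 ≤ 1 →
      P (staysIn (stepMap G D (x ^ 100)) p₀ (fun s ω => (idx s ω, ξ s ω))
          (Metric.closedBall 0 (x ^ 39)) t ∩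
        {ω | x ^ 46 ≤ |observable e l γ w (x ^ 100) j t (sgdPath G D (x ^ 100) p₀ idx ξ ω t)|}) ≤
      ENNReal.ofReal (2 * Real.exp (c - (x⁻¹) ^ 4)) := by
  have h0 := h.nonneg
  have hn := hS.ne_zero
  set M := 400 * C ^ 5 with hM
  have hM0 : 0 ≤ M := by positivity
  refine ⟨2 * C + 1, ?_⟩
  filter_upwards [eventually_small (2 * M + 4 * M ^ 2), eventually_small r⁻¹]
    with x ⟨hx, hx1, hxM⟩ ⟨_, _, hxr⟩ p₀ hp₀ t ht
  have hxr' : x ^ 39 ≤ r := by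
    have : x ≤ r := by rwa [inv_mul_le_iff₀ hr, mul_one] at hxr
    exact (pow_le_of_le_one hx.le hx1 (by norm_num)).trans this
  have hea : ∀ i, inner ℝ (e j) (a i) = 0 := fun i => by
    refine eq_zero_of_avg_sq_eq_zero hn (u := fun i => inner ℝ (e j) (a i)) ?_ i
    have := hc.eigen j (e j)
    rw [hj, zero_mul] at this
    rw [← this]; congr 1; ext i
    rw [real_inner_comm (e j) (a i), sq]
  have hobs : ∀ (t : ℕ) (p : Param d), observable e l γ w (x ^ 100) j t p =
      inner ℝ (e j) p - γ j p p + t * ((x ^ 100) ^ 2 * w j) := fun t p => by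
    rw [observable, if_pos hj]
  have hdiff : ∀ (t : ℕ) (p q : Param d), observable e l γ w (x ^ 100) j (t + 1) q -
      1 * observable e l γ w (x ^ 100) j t p =
      (inner ℝ (e j) q - γ j q q) - (inner ℝ (e j) p - γ j p p) + (x ^ 100) ^ 2 * w j := by
    intro t p q
    rw [hobs, hobs]; push_cast; ring
  have hxn := hx.ne'
  refine (measure_staysIn_inter_le (ρ := 1) (K := M * (x ^ 100 * x ^ 39 + (x ^ 100) ^ 2))
    (δ := M * (x ^ 100 * (x ^ 39) ^ 3 + (x ^ 100) ^ 2 * x ^ 39)) (N := (x⁻¹) ^ 160) (s := (x⁻¹) ^ 50)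
    (measurable_stepMap hG hD (x ^ 100))
    (fun s => (hS.measurable_idx s).prodMk (hS.measurable_noise s)) hS.indep_steps
    measurableSet_closedBall (measurable_observable (x ^ 100) j) zero_le_one le_rfl
    (by positivity) (by positivity) ?_ ?_ t ?_ (by positivity) ?_).trans ?_
  · intro t p hp
    have hp' : ‖p‖ ≤ x ^ 39 := by simpa using hp
    filter_upwards [hB] with ω hω
    rw [hdiff]
    refine (h.flat_bound (e.norm_eq_one j) hea (hc.symm j) (hc.le j) (hc.w_le j) (by positivity)
      (hp'.trans hxr') (hω t)).trans ?_
    exact mul_le_mul_of_nonneg_left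
      (add_le_add (mul_le_mul_of_nonneg_left hp' (by positivity)) le_rfl) hM0
  · intro t p hp
    have hp' : ‖p‖ ≤ x ^ 39 := by simpa using hp
    simp only [hdiff]
    refine (h.flat_mean hS (e.norm_eq_one j) hea (hc.symm j) (hc.le j) (hc.lyapunov j)
      (hc.trace j) (by positivity) (hp'.trans hxr') t).trans ?_
    have hmono : ∀ {η q R : ℝ}, 0 ≤ η → 0 ≤ q → q ≤ R →
        200 * C ^ 5 * (η * q ^ 3 + η ^ 2 * q) ≤ M * (η * R ^ 3 + η ^ 2 * R) := by
      intro η q R hη hq hqR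
      have : 200 * C ^ 5 ≤ M := by rw [hM]; nlinarith [pow_nonneg h0 5]
      gcongr
    exact hmono (by positivity) (norm_nonneg p) hp'
  · simp only [one_pow, Finset.sum_const, Finset.card_range, nsmul_eq_mul, mul_one]
    rw [inv_pow, ← one_div, le_div_iff₀ (by positivity)]; exact ht
  -- The requirement `s * K ≤ 1` of the exponential bound.
  · have : (x⁻¹) ^ 50 * (M * (x ^ 100 * x ^ 39 + (x ^ 100) ^ 2)) = M * (x ^ 89 + x ^ 150) := by
      field_simp
    rw [this]
    have h1 : x ^ 89 ≤ x := pow_le_of_le_one hx.le hx1 (by norm_num)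
    have h2 : x ^ 150 ≤ x := pow_le_of_le_one hx.le hx1 (by norm_num)
    calc M * (x ^ 89 + x ^ 150) ≤ M * (x + x) := by gcongr
      _ ≤ 1 := by nlinarith [mul_nonneg (sq_nonneg M) hx.le]
  · refine ENNReal.ofReal_le_ofReal
      (mul_le_mul_of_nonneg_left (Real.exp_le_exp.2 ?_) zero_le_two)
    have e1 : (x⁻¹) ^ 50 * x ^ 46 = (x⁻¹) ^ 4 := by field_simp
    have e2 : (x⁻¹) ^ 50 * |observable e l γ w (x ^ 100) j 0 p₀| ≤ 2 * C := by
      calc _ ≤ (x⁻¹) ^ 50 * (2 * C * x ^ 50) := by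
            gcongr; exact abs_observable_zero_le hc h.one_le hx hx1 hp₀ _ j
        _ = _ := by field_simp
    have e3 : ((x⁻¹) ^ 50 * (M * (x ^ 100 * (x ^ 39) ^ 3 + (x ^ 100) ^ 2 * x ^ 39)) +
        ((x⁻¹) ^ 50) ^ 2 * (M * (x ^ 100 * x ^ 39 + (x ^ 100) ^ 2)) ^ 2) * (x⁻¹) ^ 160 =
        M * (x ^ 7 + x ^ 29) + M ^ 2 * (x ^ 9 + x ^ 70) ^ 2 := by
      field_simp
    have e4 : M * (x ^ 7 + x ^ 29) + M ^ 2 * (x ^ 9 + x ^ 70) ^ 2 ≤ 1 := by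
      have h1 : x ^ 7 ≤ x := pow_le_of_le_one hx.le hx1 (by norm_num)
      have h2 : x ^ 29 ≤ x := pow_le_of_le_one hx.le hx1 (by norm_num)
      have h3 : x ^ 9 ≤ x := pow_le_of_le_one hx.le hx1 (by norm_num)
      have h4 : x ^ 70 ≤ x := pow_le_of_le_one hx.le hx1 (by norm_num)
      calc _ ≤ M * (x + x) + M ^ 2 * (x + x) ^ 2 := by gcongr
        _ = 2 * M * x + 4 * M ^ 2 * (x * x) := by ring
        _ ≤ 2 * M * x + 4 * M ^ 2 * (x * 1) := by gcongr
        _ = (2 * M + 4 * M ^ 2) * x := by ring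
        _ ≤ 1 := hxM
    rw [e1, e3]
    linarith

/-- Contraction bounds the geometric sum by `1 / (2 * η * l j)`, whatever the time. With `K` of
order `η` and `s = η^(-1/2)`, the variance term `s² K² N` is then bounded, which is the stationary
fluctuation scale `η^(1/2)`. -/
theorem Expansion.tail_bound_stable (h : Expansion G D a H C r) (hr : 0 < r)
    (hc : Correctors a H C e l γ w) (hG : ∀ i, Measurable (G i)) (hD : ∀ i, Measurable (D i))
    (hS : IsSampling P idx ξ) (hB : ∀ᵐ ω ∂P, ∀ t, |ξ t ω| ≤ C) {j : Fin d} (hj : l j ≠ 0) :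
    ∃ c : ℝ, ∀ᶠ x in 𝓝[>] (0 : ℝ), ∀ p₀ : Param d, ‖p₀‖ ≤ x ^ 50 → ∀ t : ℕ, t * x ^ 160 ≤ 1 →
      P (staysIn (stepMap G D (x ^ 100)) p₀ (fun s ω => (idx s ω, ξ s ω))
          (Metric.closedBall 0 (x ^ 39)) t ∩
        {ω | x ^ 46 ≤ |observable e l γ w (x ^ 100) j t (sgdPath G D (x ^ 100) p₀ idx ξ ω t)|}) ≤
      ENNReal.ofReal (2 * Real.exp (c - (x⁻¹) ^ 4)) := by
  have h0 := h.nonneg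
  have hn := hS.ne_zero
  have hl0 := hc.nonneg j
  have hl : 0 < l j := lt_of_le_of_ne hl0 (Ne.symm hj)
  set M := 20 * C ^ 2 with hM
  have hM0 : 0 ≤ M := by positivity
  refine ⟨2 * C + (M + M ^ 2) / (2 * l j), ?_⟩
  filter_upwards [eventually_small M, eventually_small (2 * l j), eventually_small r⁻¹]
    with x ⟨hx, hx1, hxM⟩ ⟨_, _, hxl⟩ ⟨_, _, hxr⟩ p₀ hp₀ t ht
  have hxr' : x ^ 39 ≤ r := by
    have : x ≤ r := by rwa [inv_mul_le_iff₀ hr, mul_one] at hxr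
    exact (pow_le_of_le_one hx.le hx1 (by norm_num)).trans this
  have hobs : ∀ (t : ℕ) (p : Param d), observable e l γ w (x ^ 100) j t p = inner ℝ (e j) p :=
    fun t p => by rw [observable, if_neg hj]
  have hxn := hx.ne'
  have hρ0 : 0 ≤ 1 - 2 * x ^ 100 * l j := by
    have h1 : x ^ 100 ≤ x := pow_le_of_le_one hx.le hx1 (by norm_num)
    nlinarith
  have hρ1 : 1 - 2 * x ^ 100 * l j < 1 := by
    have : 0 < 2 * x ^ 100 * l j := by positivity
    linarith
  refine (measure_staysIn_inter_le (ρ := 1 - 2 * x ^ 100 * l j) (K := M * x ^ 100)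
    (δ := M * x ^ 100 * (x ^ 39) ^ 2) (N := (2 * x ^ 100 * l j)⁻¹) (s := (x⁻¹) ^ 50)
    (measurable_stepMap hG hD (x ^ 100))
    (fun s => (hS.measurable_idx s).prodMk (hS.measurable_noise s)) hS.indep_steps
    measurableSet_closedBall (measurable_observable (x ^ 100) j) hρ0 hρ1.le
    (by positivity) (by positivity) ?_ ?_ t ?_ (by positivity) ?_).trans ?_
  · intro t p hp
    have hp' : ‖p‖ ≤ x ^ 39 := by simpa using hp
    filter_upwards [hB] with ω hω
    rw [hobs, hobs]
    exact h.stable_bound hn (e.norm_eq_one j) (hc.eigen j) hl0 (by positivity)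
      (hp'.trans hxr') (hω t)
  · intro t p hp
    have hp' : ‖p‖ ≤ x ^ 39 := by simpa using hp
    simp only [hobs]
    refine (h.stable_mean hS (e.norm_eq_one j) (hc.eigen j) (by positivity)
      (hp'.trans hxr') t).trans ?_
    have : 10 * C ^ 2 ≤ M := by rw [hM]; nlinarith [sq_nonneg C]
    gcongr
  · have h1 := geom_sum_eq hρ1.ne t
    have h2 : (1 - 2 * x ^ 100 * l j) - 1 = -(2 * x ^ 100 * l j) := by ring
    rw [h1, h2, div_neg, ← neg_div, neg_sub, div_eq_mul_inv]
    refine mul_le_of_le_one_left (by positivity) ?_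
    have := pow_nonneg hρ0 t
    linarith
  · have : (x⁻¹) ^ 50 * (M * x ^ 100) = M * x ^ 50 := by field_simp
    rw [this]
    have h1 : x ^ 50 ≤ x := pow_le_of_le_one hx.le hx1 (by norm_num)
    calc M * x ^ 50 ≤ M * x := by gcongr
      _ ≤ 1 := hxM
  · refine ENNReal.ofReal_le_ofReal
      (mul_le_mul_of_nonneg_left (Real.exp_le_exp.2 ?_) zero_le_two)
    have e1 : (x⁻¹) ^ 50 * x ^ 46 = (x⁻¹) ^ 4 := by field_simp
    have e2 : (x⁻¹) ^ 50 * |observable e l γ w (x ^ 100) j 0 p₀| ≤ 2 * C := by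
      calc _ ≤ (x⁻¹) ^ 50 * (2 * C * x ^ 50) := by
            gcongr; exact abs_observable_zero_le hc h.one_le hx hx1 hp₀ _ j
        _ = _ := by field_simp
    have e3 : ((x⁻¹) ^ 50 * (M * x ^ 100 * (x ^ 39) ^ 2) + ((x⁻¹) ^ 50) ^ 2 * (M * x ^ 100) ^ 2) *
        (2 * x ^ 100 * l j)⁻¹ = (M * x ^ 28 + M ^ 2) / (2 * l j) := by
      field_simp
    have e4 : (M * x ^ 28 + M ^ 2) / (2 * l j) ≤ (M + M ^ 2) / (2 * l j) := by
      have h1 : x ^ 28 ≤ 1 := pow_le_one₀ hx.le hx1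
      gcongr
      exact mul_le_of_le_one_right hM0 h1
    rw [e1, e3]
    linarith

theorem Expansion.tail_bound (h : Expansion G D a H C r) (hr : 0 < r)
    (hc : Correctors a H C e l γ w) (hG : ∀ i, Measurable (G i)) (hD : ∀ i, Measurable (D i))
    (hS : IsSampling P idx ξ) (hB : ∀ᵐ ω ∂P, ∀ t, |ξ t ω| ≤ C) (j : Fin d) :
    ∃ c : ℝ, ∀ᶠ x in 𝓝[>] (0 : ℝ), ∀ p₀ : Param d, ‖p₀‖ ≤ x ^ 50 → ∀ t : ℕ, t * x ^ 160 ≤ 1 →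
      P (staysIn (stepMap G D (x ^ 100)) p₀ (fun s ω => (idx s ω, ξ s ω))
          (Metric.closedBall 0 (x ^ 39)) t ∩
        {ω | x ^ 46 ≤ |observable e l γ w (x ^ 100) j t (sgdPath G D (x ^ 100) p₀ idx ξ ω t)|}) ≤
      ENNReal.ofReal (2 * Real.exp (c - (x⁻¹) ^ 4)) := by
  by_cases hj : l j = 0
  · exact h.tail_bound_flat hr hc hG hD hS hB hj
  · exact h.tail_bound_stable hr hc hG hD hS hB hj

/-! ### Bootstrap in time and union bound. -/

omit [MeasurableSpace Ω] in
/-- Outside the events of the tail bounds, the path follows the drift. -/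
theorem Expansion.path_follows_drift (h : Expansion G D a H C r) (hr : 0 < r)
    (hc : Correctors a H C e l γ w) :
    ∀ᶠ x in 𝓝[>] (0 : ℝ), ∀ p₀ : Param d, ‖p₀‖ ≤ x ^ 50 → ∀ ω : Ω, (∀ t, |ξ t ω| ≤ C) →
      (∀ t : ℕ, t * x ^ 160 ≤ 1 → ∀ j,
        ω ∈ staysIn (stepMap G D (x ^ 100)) p₀ (fun s ω => (idx s ω, ξ s ω))
          (Metric.closedBall 0 (x ^ 39)) t →
        |observable e l γ w (x ^ 100) j t (sgdPath G D (x ^ 100) p₀ idx ξ ω t)| < x ^ 46) →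
      ∀ t : ℕ, t * x ^ 160 ≤ 1 → ‖sgdPath G D (x ^ 100) p₀ idx ξ ω t‖ ≤ x ^ 39 ∧
        ∀ j, |inner ℝ (e j) (sgdPath G D (x ^ 100) p₀ idx ξ ω t) +
          t * (x ^ 200 * if l j = 0 then w j else 0)| ≤ 2 * x ^ 46 := by
  have h0 := h.nonneg
  filter_upwards [eventually_small (18 * C ^ 2 + 4 * C + d * (2 + 2 * C ^ 2)),
    eventually_small (2 * r⁻¹)] with x ⟨hx, hx1, hxC⟩ ⟨_, _, hxr⟩ p₀ hp₀ ω hω hgood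
  have hxr' : 2 * x ^ 39 ≤ r := by
    have h1 : 2 * x ≤ r := by
      rw [mul_comm 2, mul_assoc, inv_mul_le_iff₀ hr, mul_one] at hxr; exact hxr
    have := pow_le_of_le_one hx.le hx1 (n := 39) (by norm_num)
    linarith
  have hd0 : (0 : ℝ) ≤ d * (2 + 2 * C ^ 2) := by positivity
  have hC1 : 18 * C ^ 2 * x ≤ 1 := by nlinarith
  have hC2 : 4 * C * x ≤ 1 := by nlinarith [mul_nonneg (sq_nonneg C) hx.le]
  have hC3 : d * (2 + 2 * C ^ 2) * x ≤ 1 := by nlinarith [mul_nonneg (sq_nonneg C) hx.le]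
  set p := sgdPath G D (x ^ 100) p₀ idx ξ ω with hp
  -- The current point is only assumed to lie in the doubled ball, since confinement at time `t` is
  -- not yet known. That suffices to drop the corrector: `γ j (p t) (p t)` is of order `x ^ 78`,
  -- well below `x ^ 46`.
  have hcoord : ∀ t : ℕ, t * x ^ 160 ≤ 1 → (∀ s < t, ‖p s‖ ≤ x ^ 39) → ‖p t‖ ≤ 2 * x ^ 39 →
      ∀ j, |inner ℝ (e j) (p t) + t * (x ^ 200 * if l j = 0 then w j else 0)| ≤ 2 * x ^ 46 := by
    intro t ht hstay hpt j
    have h1 := hgood t ht j (fun s hs => by simpa using hstay s hs)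
    have hx46 : 0 < x ^ 46 := by positivity
    unfold observable at h1
    by_cases hj : l j = 0
    · rw [if_pos hj] at h1 ⊢
      have h2 : |γ j (p t) (p t)| ≤ x ^ 46 := by
        calc _ ≤ C * ‖p t‖ * ‖p t‖ := hc.le j _ _
          _ ≤ C * (2 * x ^ 39) * (2 * x ^ 39) := by gcongr
          _ = 4 * C * x * (x ^ 31 * x ^ 46) := by ring
          _ ≤ 1 * (1 * x ^ 46) := by
            gcongr
            exact pow_le_one₀ hx.le hx1
          _ = _ := by ring
      have h3 : inner ℝ (e j) (p t) + t * (x ^ 200 * w j) =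
          (inner ℝ (e j) (p t) - γ j (p t) (p t) + t * ((x ^ 100) ^ 2 * w j)) +
            γ j (p t) (p t) := by ring
      rw [h3]
      refine (abs_add_le _ _).trans ?_
      linarith
    · rw [if_neg hj] at h1 ⊢
      rw [mul_zero, mul_zero, add_zero]
      linarith
  -- The accumulated drift is at most of order `x ^ 40`, so the coordinates return the point to the
  -- smaller ball, with a factor `x` to absorb constants and the dimension.
  have hsmall : ∀ t : ℕ, t * x ^ 160 ≤ 1 →
      (∀ j, |inner ℝ (e j) (p t) + t * (x ^ 200 * if l j = 0 then w j else 0)| ≤ 2 * x ^ 46) →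
      ‖p t‖ ≤ x ^ 39 := by
    intro t ht hj
    have h1 : ∀ j, |inner ℝ (e j) (p t)| ≤ (2 + 2 * C ^ 2) * x ^ 40 := by
      intro j
      have h2 : |t * (x ^ 200 * if l j = 0 then w j else 0)| ≤ 2 * C ^ 2 * x ^ 40 := by
        have h3 : |if l j = 0 then w j else 0| ≤ 2 * C ^ 2 := by
          split_ifs
          · exact hc.w_le j
          · rw [abs_zero]; positivity
        rw [abs_mul, abs_mul, Nat.abs_cast, abs_of_nonneg (by positivity : 0 ≤ x ^ 200)]
        calc t * (x ^ 200 * |if l j = 0 then w j else 0|) ≤ t * (x ^ 200 * (2 * C ^ 2)) := by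
              gcongr
          _ = (t * x ^ 160) * (2 * C ^ 2 * x ^ 40) := by ring
          _ ≤ 1 * (2 * C ^ 2 * x ^ 40) := by gcongr
          _ = _ := one_mul _
      have h4 : x ^ 46 ≤ x ^ 40 := pow_le_pow_of_le_one hx.le hx1 (by norm_num)
      have h5 := abs_sub (inner ℝ (e j) (p t) + t * (x ^ 200 * if l j = 0 then w j else 0))
        (t * (x ^ 200 * if l j = 0 then w j else 0))
      rw [add_sub_cancel_right] at h5
      linarith [hj j]
    calc ‖p t‖ ≤ d * ((2 + 2 * C ^ 2) * x ^ 40) := norm_le_of_abs_inner_le e h1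
      _ = (d * (2 + 2 * C ^ 2) * x) * x ^ 39 := by ring
      _ ≤ 1 * x ^ 39 := by gcongr
      _ = _ := one_mul _
  have hstep : ∀ t : ℕ, ‖p t‖ ≤ x ^ 39 → ‖p (t + 1)‖ ≤ 2 * x ^ 39 := by
    intro t ht
    have hx39 : 0 < x ^ 39 := by positivity
    have h1 := h.norm_stepMap_sub_le (η := x ^ 100) (by positivity) (p := p t)
      (z := (idx t ω, ξ t ω)) (by linarith) (hω t)
    have h2 : p (t + 1) = p t + (stepMap G D (x ^ 100) (p t) (idx t ω, ξ t ω) - p t) := by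
      rw [add_sub_cancel]; rfl
    have h3 : 18 * C ^ 2 * x ^ 100 ≤ x ^ 39 := by
      calc 18 * C ^ 2 * x ^ 100 = (18 * C ^ 2 * x) * (x ^ 60 * x ^ 39) := by ring
        _ ≤ 1 * (1 * x ^ 39) := by
          gcongr
          exact pow_le_one₀ hx.le hx1
        _ = _ := by ring
    rw [h2]
    exact (norm_add_le _ _).trans (by linarith)
  have hstart : ‖p 0‖ ≤ x ^ 39 :=
    hp₀.trans (pow_le_pow_of_le_one hx.le hx1 (by norm_num))
  -- Strong induction: one step cannot leave the doubled ball, and there the coordinate bounds apply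
  -- and restore the radius `x ^ 39`.
  have hall : ∀ t : ℕ, t * x ^ 160 ≤ 1 → ∀ s ≤ t, ‖p s‖ ≤ x ^ 39 := by
    intro t
    induction t with
    | zero => intro _ s hs; rwa [Nat.le_zero.1 hs]
    | succ t ih =>
      intro ht s hs
      have ht' : t * x ^ 160 ≤ 1 := by
        refine le_trans ?_ ht
        gcongr
        exact t.le_succ
      rcases Nat.lt_or_eq_of_le hs with hs | rfl
      · exact ih ht' s (Nat.lt_succ_iff.1 hs)
      · exact hsmall _ ht (hcoord _ ht (fun s hs => ih ht' s (Nat.lt_succ_iff.1 hs))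
          (hstep t (ih ht' t le_rfl)))
  intro t ht
  have h1 := hall t ht
  have hx39 : 0 < x ^ 39 := by positivity
  exact ⟨h1 t le_rfl, hcoord t ht (fun s hs => h1 s hs.le) (by linarith [h1 t le_rfl])⟩

/-- With overwhelming probability, the path follows the drift. -/
theorem Expansion.exists_bad_event (h : Expansion G D a H C r) (hr : 0 < r)
    (hc : Correctors a H C e l γ w) (hG : ∀ i, Measurable (G i)) (hD : ∀ i, Measurable (D i))
    (hS : IsSampling P idx ξ) (hB : ∀ᵐ ω ∂P, ∀ t, |ξ t ω| ≤ C) :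
    ∀ᶠ x in 𝓝[>] (0 : ℝ), ∀ p₀ : Param d, ‖p₀‖ ≤ x ^ 50 → ∃ bad : Set Ω,
      P bad ≤ ENNReal.ofReal (Real.exp (-(x⁻¹) ^ 3)) ∧ ∀ ω ∉ bad,
      ∀ t : ℕ, t * x ^ 160 ≤ 1 → ‖sgdPath G D (x ^ 100) p₀ idx ξ ω t‖ ≤ x ^ 39 ∧
        ∀ j, |inner ℝ (e j) (sgdPath G D (x ^ 100) p₀ idx ξ ω t) +
          t * (x ^ 200 * if l j = 0 then w j else 0)| ≤ 2 * x ^ 46 := by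
  choose c hctail using fun j => h.tail_bound hr hc hG hD hS hB j
  filter_upwards [eventually_all.2 hctail, h.path_follows_drift (Ω := Ω) (idx := idx) (ξ := ξ) hr hc,
    eventually_mul_exp_le (∑ j, 2 * Real.exp (c j)), eventually_small 0]
    with x htail hdrift hexp ⟨hx, hx1, _⟩ p₀ hp₀
  let T : ℕ := ⌊(x⁻¹) ^ 160⌋₊
  have hT : ∀ t : ℕ, t * x ^ 160 ≤ 1 ↔ t ∈ Finset.range (T + 1) := by
    intro t
    rw [Finset.mem_range, Nat.lt_succ_iff, Nat.le_floor_iff (by positivity), inv_pow, ← one_div,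
      le_div_iff₀ (by positivity)]
  let bad₀ : ℕ → Fin d → Set Ω := fun t j =>
    staysIn (stepMap G D (x ^ 100)) p₀ (fun s ω => (idx s ω, ξ s ω))
          (Metric.closedBall 0 (x ^ 39)) t ∩
        {ω | x ^ 46 ≤ |observable e l γ w (x ^ 100) j t (sgdPath G D (x ^ 100) p₀ idx ξ ω t)|}
  -- The null set where the noise exceeds its bound is included, so that the bootstrap holds for
  -- every remaining outcome.
  refine ⟨{ω | ∀ t, |ξ t ω| ≤ C}ᶜ ∪ ⋃ t ∈ Finset.range (T + 1), ⋃ j ∈ Finset.univ, bad₀ t j,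
    ?_, ?_⟩
  · have hnull : P {ω | ∀ t, |ξ t ω| ≤ C}ᶜ = 0 := hB
    have h1 : ∀ j, 2 * Real.exp (c j - (x⁻¹) ^ 4) =
        2 * Real.exp (c j) * Real.exp (-(x⁻¹) ^ 4) := fun j => by
      rw [sub_eq_add_neg, Real.exp_add, mul_assoc]
    calc _ ≤ P {ω | ∀ t, |ξ t ω| ≤ C}ᶜ +
          P (⋃ t ∈ Finset.range (T + 1), ⋃ j ∈ Finset.univ, bad₀ t j) := measure_union_le _ _
      _ ≤ 0 + ∑ t ∈ Finset.range (T + 1), ∑ j, P (bad₀ t j) := by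
          rw [hnull]
          gcongr
          refine (measure_biUnion_finset_le _ _).trans (Finset.sum_le_sum fun t _ => ?_)
          exact measure_biUnion_finset_le _ _
      _ ≤ 0 + ∑ t ∈ Finset.range (T + 1), ∑ j, ENNReal.ofReal (2 * Real.exp (c j - (x⁻¹) ^ 4)) := by
          gcongr with t ht j _
          exact htail j p₀ hp₀ t ((hT t).2 ht)
      _ = ENNReal.ofReal ((T + 1) * ((∑ j, 2 * Real.exp (c j)) * Real.exp (-(x⁻¹) ^ 4))) := by
          rw [zero_add, Finset.sum_const, Finset.card_range, nsmul_eq_mul,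
            ← ENNReal.ofReal_sum_of_nonneg (fun j _ => by positivity),
            ENNReal.ofReal_mul (by positivity)]
          simp only [h1, Finset.sum_mul]
          congr 1
          rw [← Nat.cast_succ, ENNReal.ofReal_natCast]
      _ ≤ _ := by
          refine ENNReal.ofReal_le_ofReal (le_trans ?_ hexp)
          have : (T : ℝ) ≤ (x⁻¹) ^ 160 := Nat.floor_le (by positivity)
          have h2 : 0 ≤ (∑ j, 2 * Real.exp (c j)) * Real.exp (-(x⁻¹) ^ 4) := by positivity
          gcongr
  · intro ω hω
    rw [Set.mem_union, not_or, Set.notMem_compl_iff] at hω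
    refine hdrift p₀ hp₀ ω hω.1 fun t ht j hstay => ?_
    by_contra hcon
    refine hω.2 (Set.mem_biUnion ((hT t).1 ht) (Set.mem_biUnion (Finset.mem_univ j) ⟨hstay, ?_⟩))
    exact not_lt.1 hcon

end

/-! ### Gradients, Hessians and the loss. -/

section gradient
variable {d : ℕ} {F : Param d → ℝ} {θ : Param d}

theorem inner_gradient_left (F : Param d → ℝ) (θ v : Param d) :
    inner ℝ (∇ F θ) v = fderiv ℝ F θ v := by
  rw [gradient, InnerProductSpace.toDual_symm_apply]

theorem contDiffAt_gradient {k : ℕ∞} (hF : ContDiffAt ℝ (k + 1 : ℕ∞) F θ) :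
    ContDiffAt ℝ k (∇ F) θ := by
  have h1 : ContDiffAt ℝ k (fderiv ℝ F) θ := hF.fderiv_right (by simp)
  exact (InnerProductSpace.toDual ℝ (Param d)).symm.contDiff.contDiffAt.comp θ h1

theorem inner_fderiv_gradient (hF : ContDiffAt ℝ 2 F θ) (p q : Param d) :
    inner ℝ (fderiv ℝ (∇ F) θ p) q = fderiv ℝ (fderiv ℝ F) θ p q := by
  have h1 : DifferentiableAt ℝ (fderiv ℝ F) θ :=
    (hF.fderiv_right (m := 1) (by norm_num)).differentiableAt (by simp)
  have h2 : HasFDerivAt (∇ F) _ θ :=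
    ((InnerProductSpace.toDual ℝ (Param d)).symm.toContinuousLinearEquiv.hasFDerivAt).comp θ
      h1.hasFDerivAt
  rw [h2.fderiv]
  exact InnerProductSpace.toDual_symm_apply

theorem inner_fderiv_gradient_symm (hF : ContDiffAt ℝ 2 F θ) (p q : Param d) :
    inner ℝ (fderiv ℝ (∇ F) θ p) q = inner ℝ p (fderiv ℝ (∇ F) θ q) := by
  rw [real_inner_comm _ p, inner_fderiv_gradient hF, inner_fderiv_gradient hF]
  exact (hF.isSymmSndFDerivAt (by simp)) p q

theorem gradient_sub_sq (hF : DifferentiableAt ℝ F θ) (c : ℝ) :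
    ∇ (fun ϑ => (F ϑ - c) ^ 2) θ = (2 * (F θ - c)) • ∇ F θ := by
  refine ext_inner_right ℝ fun v => ?_
  have h1 := (hF.hasFDerivAt.sub_const c).pow 2
  rw [inner_smul_left, inner_gradient_left, inner_gradient_left]
  have h2 : fderiv ℝ (fun ϑ => (F ϑ - c) ^ 2) θ = _ := h1.fderiv
  rw [h2]
  simp

end gradient

/-! ### The model in coordinates centred at `θs`. -/

section model
variable {d n : ℕ} {X : Type*} {f : Param d → X → ℝ} {x : Fin n → X} {y : Fin n → ℝ}
  {θs : Param d}

theorem reg_eq_avg (f : Param d → X → ℝ) (x : Fin n → X) :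
    reg f x = fun θ => avg fun i => ‖∇ (fun ϑ => f ϑ (x i)) θ‖ ^ 2 := by
  ext θ; simp [reg, avg]

theorem contDiffAt_reg (hf : ∀ i, ContDiffAt ℝ 3 (fun θ => f θ (x i)) θs) :
    ContDiffAt ℝ 2 (reg f x) θs := by
  rw [reg_eq_avg]
  exact contDiffAt_const.mul
    (ContDiffAt.sum fun i _ => (contDiffAt_gradient (k := 2) (hf i)).norm_sq ℝ)

/-- This expression in gradients and Hessians also arises from the trace of the Lyapunov solution;
the match identifies the drift with the slope of the regularizer. -/
theorem inner_gradient_reg (hf : ∀ i, ContDiffAt ℝ 3 (fun θ => f θ (x i)) θs) (v : Param d) :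
    inner ℝ (∇ (reg f x) θs) v = 2 * avg fun i => inner ℝ (∇ (fun ϑ => f ϑ (x i)) θs)
      (fderiv ℝ (∇ (fun ϑ => f ϑ (x i))) θs v) := by
  have h1 : ∀ i, HasFDerivAt (fun θ => ‖∇ (fun ϑ => f ϑ (x i)) θ‖ ^ 2) _ θs := fun i =>
    ((contDiffAt_gradient (k := 2) (hf i)).differentiableAt (by simp)).hasFDerivAt.norm_sq
  have h2 := (HasFDerivAt.fun_sum fun i (_ : i ∈ Finset.univ) => h1 i).const_mul (n : ℝ)⁻¹
  rw [show (fun θ => (n : ℝ)⁻¹ * ∑ i, ‖∇ (fun ϑ => f ϑ (x i)) θ‖ ^ 2) = reg f x from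
    (reg_eq_avg f x).symm] at h2
  rw [inner_gradient_left, h2.fderiv, ← avg_const_mul, avg]
  simp

theorem mem_flatDirections {v : Param d} :
    v ∈ flatDirections f x θs ↔ ∀ i, inner ℝ (∇ (fun ϑ => f ϑ (x i)) θs) v = 0 := by
  rw [flatDirections, Submodule.mem_orthogonal]
  refine ⟨fun h i => h _ (Submodule.subset_span ⟨i, rfl⟩), fun h u hu => ?_⟩
  induction hu using Submodule.span_induction with
  | mem u hu => obtain ⟨i, rfl⟩ := hu; exact h i
  | zero => exact inner_zero_left v
  | add u u' _ _ hu hu' => rw [inner_add_left, hu, hu', add_zero]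
  | smul c u _ hu => rw [inner_smul_left, hu, mul_zero]

/-- The residual of the model at the `i`-th data point, in coordinates centred at `θs` and cut
off at distance `r`. -/
noncomputable def residual (f : Param d → X → ℝ) (x : Fin n → X) (y : Fin n → ℝ) (θs : Param d)
    (r : ℝ) (i : Fin n) : Param d → ℝ :=
  (Metric.closedBall 0 r).indicator fun p => f (θs + p) (x i) - y i

/-- The gradient of the residual, in coordinates centred at `θs` and cut off at distance `r`. -/
noncomputable def residualGradient (f : Param d → X → ℝ) (x : Fin n → X) (θs : Param d)
    (r : ℝ) (i : Fin n) : Param d → Param d :=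
  (Metric.closedBall 0 r).indicator fun p => ∇ (fun ϑ => f ϑ (x i)) (θs + p)

/-- Nothing is known about the model away from `θs`; cutting off makes the step map globally
measurable, as the concentration bounds require. -/
theorem measurable_indicator_closedBall {F : Type*} [NormedAddCommGroup F] [MeasurableSpace F]
    [BorelSpace F] {g : Param d → F} {r : ℝ}
    (hg : ∀ p, ‖p‖ ≤ r → ContinuousAt g (θs + p)) :
    Measurable ((Metric.closedBall 0 r).indicator fun p => g (θs + p)) := by
  classical
  rw [← Set.piecewise_eq_indicator]
  refine ContinuousOn.measurable_piecewise (fun p hp => ?_) continuousOn_const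
    measurableSet_closedBall
  have h1 : ContinuousAt g (θs + p) := hg p (by simpa using hp)
  exact (ContinuousAt.comp (f := fun p => θs + p) h1 (by fun_prop)).continuousWithinAt

/-- As long as the centred path stays in the ball of radius `r`, it describes the iterates. -/
theorem iterate_eq_add_sgdPath {Ω : Type*} {r : ℝ}
    (hd : ∀ i p, ‖p‖ ≤ r → DifferentiableAt ℝ (fun θ => f θ (x i)) (θs + p)) (η : ℝ) (θ₀ : Param d)
    (idx : ℕ → Ω → Fin n) (ξ : ℕ → Ω → ℝ) (ω : Ω) (t : ℕ)
    (h : ∀ s < t, ‖sgdPath (residual f x y θs r) (residualGradient f x θs r) η (θ₀ - θs)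
      idx ξ ω s‖ ≤ r) :
    iterate f x y η θ₀ (fun s => idx s ω) (fun s => ξ s ω) t =
      θs + sgdPath (residual f x y θs r) (residualGradient f x θs r) η (θ₀ - θs) idx ξ ω t := by
  induction t with
  | zero => simp [iterate, path]
  | succ t ih =>
    have hmem := h t t.lt_succ_self
    have hball : sgdPath (residual f x y θs r) (residualGradient f x θs r) η (θ₀ - θs) idx ξ ω t ∈
        Metric.closedBall (0 : Param d) r := by simpa using hmem
    rw [iterate, ih fun s hs => h s (hs.trans t.lt_succ_self),
      gradient_sub_sq (F := fun ϑ => f ϑ (x (idx t ω))) (hd _ _ hmem)]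
    simp only [sgdPath, path] at hball ⊢
    rw [stepMap, residual, residualGradient, Set.indicator_of_mem hball,
      Set.indicator_of_mem hball, add_sub_assoc, smul_smul]
    congr 3
    ring

theorem exists_bilin_bound (γ : LinearMap.BilinForm ℝ (Param d)) :
    ∃ c : ℝ, 0 ≤ c ∧ ∀ p q, |γ p q| ≤ c * ‖p‖ * ‖q‖ := by
  let g : Param d →L[ℝ] Param d →L[ℝ] ℝ :=
    LinearMap.toContinuousLinearMap
      ((LinearMap.toContinuousLinearMap (𝕜 := ℝ) (E := Param d) (F' := ℝ)).toLinearMap ∘ₗ γ)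
  exact ⟨‖g‖, norm_nonneg g, fun p q => g.le_opNorm₂ p q⟩

/-- The Lyapunov equation is solved with `H i (e j)` as data; symmetry of the Hessian converts its
right side into the quadratic drift in direction `e j`. Every `C` above a threshold is allowed, so
that one constant can also serve the expansion and the noise bound. -/
theorem exists_correctors (hn : n ≠ 0) (hf : ∀ i, ContDiffAt ℝ 3 (fun θ => f θ (x i)) θs) :
    ∃ (e : OrthonormalBasis (Fin d) ℝ (Param d)) (l : Fin d → ℝ)
      (γ : Fin d → LinearMap.BilinForm ℝ (Param d)) (c : ℝ), ∀ C, c ≤ C →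
      Correctors (fun i => ∇ (fun ϑ => f ϑ (x i)) θs)
        (fun i => (fderiv ℝ (∇ (fun ϑ => f ϑ (x i))) θs : Param d →ₗ[ℝ] Param d)) C e l γ
        (fun j => inner ℝ (∇ (reg f x) θs) (e j)) := by
  obtain ⟨e, l, hl, he⟩ := exists_eigenbasis fun i => ∇ (fun ϑ => f ϑ (x i)) θs
  choose γ hsymm hlyap htrace using fun j =>
    exists_lyapunov hn (fun i => fderiv ℝ (∇ (fun ϑ => f ϑ (x i))) θs (e j)) hl he
  choose b hb0 hb using fun j => exists_bilin_bound (γ j)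
  have hs : 0 ≤ ∑ j, b j := Finset.sum_nonneg fun j _ => hb0 j
  have hg : 0 ≤ ‖∇ (reg f x) θs‖ := norm_nonneg _
  refine ⟨e, l, γ, 1 + ∑ j, b j + ‖∇ (reg f x) θs‖, fun C hC =>
    ⟨hl, he, hsymm, fun j p q => ?_, fun j p => ?_, fun j => ?_, fun j => ?_⟩⟩
  · have h1 : b j ≤ C := by
      have := Finset.single_le_sum (f := b) (fun j _ => hb0 j) (Finset.mem_univ j)
      linarith
    exact (hb j p q).trans (by gcongr)
  · rw [hlyap j p]
    congr 1; ext i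
    rw [inner_fderiv_gradient_symm ((hf i).of_le (by norm_num))]
    rfl
  · have := htrace j
    rw [inner_gradient_reg hf, ← this]; ring
  · have h1 := abs_real_inner_le_norm (∇ (reg f x) θs) (e j)
    rw [e.norm_eq_one, mul_one] at h1
    nlinarith

/-- Near an interpolating parameter the residuals and their gradients have an expansion. -/
theorem exists_expansion (hf : ∀ i, ContDiffAt ℝ 3 (fun θ => f θ (x i)) θs)
    (hzero : ∀ i, f θs (x i) = y i) (c : ℝ) :
    ∃ C r : ℝ, c ≤ C ∧ 0 < r ∧
      (∀ i p, ‖p‖ ≤ r → DifferentiableAt ℝ (fun θ => f θ (x i)) (θs + p)) ∧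
      (∀ i, Measurable (residual f x y θs r i)) ∧
      (∀ i, Measurable (residualGradient f x θs r i)) ∧
      Expansion (residual f x y θs r) (residualGradient f x θs r)
        (fun i => ∇ (fun ϑ => f ϑ (x i)) θs)
        (fun i => (fderiv ℝ (∇ (fun ϑ => f ϑ (x i))) θs : Param d →ₗ[ℝ] Param d)) C r := by
  have hgr : ∀ i, ContDiffAt ℝ 2 (∇ fun ϑ => f ϑ (x i)) θs := fun i =>
    contDiffAt_gradient (k := 2) (hf i)
  choose A hA0 hA using fun i => exists_norm_sub_fderiv_le ((hf i).of_le (by norm_num))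
  choose A' hA0' hA' using fun i => exists_norm_sub_fderiv_le (hgr i)
  have hev : ∀ᶠ θ in 𝓝 θs, ∀ i, ContDiffAt ℝ 3 (fun θ => f θ (x i)) θ :=
    eventually_all.2 fun i => (hf i).eventually (by simp)
  obtain ⟨r₀, hr₀, hball⟩ := Metric.eventually_nhds_iff_ball.1
    (((eventually_all.2 hA).and (eventually_all.2 hA')).and hev)
  let B : Fin n → ℝ := fun i => A i + A' i + ‖∇ (fun ϑ => f ϑ (x i)) θs‖ +
    ‖fderiv ℝ (∇ (fun ϑ => f ϑ (x i))) θs‖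
  have hB : ∀ i, 0 ≤ B i := fun i => by
    have := hA0 i; have := hA0' i; positivity
  let r : ℝ := min (r₀ / 2) 1
  have hr : 0 < r := lt_min (half_pos hr₀) one_pos
  have hmem : ∀ p : Param d, ‖p‖ ≤ r → θs + p ∈ Metric.ball θs r₀ := fun p hp => by
    rw [mem_ball_iff_norm, add_sub_cancel_left]
    have := hp.trans (min_le_left _ _)
    linarith
  have hBC : ∀ i, B i ≤ 1 + |c| + ∑ i, B i := fun i => by
    have := Finset.single_le_sum (f := B) (fun i _ => hB i) (Finset.mem_univ i)
    have := abs_nonneg c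
    linarith
  have hsum : 0 ≤ ∑ i, B i := Finset.sum_nonneg fun i _ => hB i
  have hcd : ∀ i p, ‖p‖ ≤ r → ContDiffAt ℝ 3 (fun θ => f θ (x i)) (θs + p) := fun i p hp =>
    (hball _ (hmem p hp)).2 i
  refine ⟨1 + |c| + ∑ i, B i, r, ?_, hr, fun i p hp => ?_, fun i => ?_, fun i => ?_, ?_⟩
  · linarith [le_abs_self c]
  · exact (hcd i p hp).differentiableAt (by simp)
  · exact measurable_indicator_closedBall (g := fun θ => f θ (x i) - y i) fun p hp =>
      (hcd i p hp).continuousAt.sub continuousAt_const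
  · exact measurable_indicator_closedBall fun p hp =>
      (contDiffAt_gradient (k := 2) (hcd i p hp)).continuousAt
  have hind : ∀ p : Param d, ‖p‖ ≤ r → p ∈ Metric.closedBall (0 : Param d) r := fun p hp => by
    simpa using hp
  refine ⟨by linarith [abs_nonneg c], min_le_right _ _, fun i => ?_, fun i p => ?_,
    fun i p hp => ?_, fun i p hp => ?_⟩
  · refine le_trans ?_ (hBC i)
    have := hA0 i; have := hA0' i
    have := norm_nonneg (fderiv ℝ (∇ (fun ϑ => f ϑ (x i))) θs)
    simp only [B]; linarith
  · refine (ContinuousLinearMap.le_opNorm _ p).trans ?_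
    gcongr
    refine le_trans ?_ (hBC i)
    have := hA0 i; have := hA0' i
    have := norm_nonneg (∇ (fun ϑ => f ϑ (x i)) θs)
    simp only [B]; linarith
  · have h1 := (hball _ (hmem p hp)).1.1 i
    rw [add_sub_cancel_left, hzero, ← inner_gradient_left] at h1
    rw [residual, Set.indicator_of_mem (hind p hp)]
    refine h1.trans ?_
    gcongr
    refine le_trans ?_ (hBC i)
    have := hA0' i
    have := norm_nonneg (∇ (fun ϑ => f ϑ (x i)) θs)
    have := norm_nonneg (fderiv ℝ (∇ (fun ϑ => f ϑ (x i))) θs)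
    simp only [B]; linarith
  · have h1 := (hball _ (hmem p hp)).1.2 i
    rw [add_sub_cancel_left] at h1
    rw [residualGradient, Set.indicator_of_mem (hind p hp)]
    refine h1.trans ?_
    gcongr
    refine le_trans ?_ (hBC i)
    have := hA0 i
    have := norm_nonneg (∇ (fun ϑ => f ϑ (x i)) θs)
    have := norm_nonneg (fderiv ℝ (∇ (fun ϑ => f ϑ (x i))) θs)
    simp only [B]; linarith

variable {Ω : Type*} [MeasurableSpace Ω] {P : Measure Ω} [IsProbabilityMeasure P]
  {idx : ℕ → Ω → Fin n} {ξ : ℕ → Ω → ℝ}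

/-- Near an interpolating parameter, the iterates follow with overwhelming probability the flow of
the regularizer in the flat directions. -/
theorem exists_drift (hS : IsSampling P idx ξ)
    (hf : ∀ i, ContDiffAt ℝ 3 (fun θ => f θ (x i)) θs) (hzero : ∀ i, f θs (x i) = y i) :
    ∃ (e : OrthonormalBasis (Fin d) ℝ (Param d)) (w : Fin d → ℝ),
      (∀ j, w j = 0 ∨ w j = inner ℝ (∇ (reg f x) θs) (e j)) ∧
      (RegStationary f x θs ↔ w = 0) ∧
      ∀ᶠ u in 𝓝[>] (0 : ℝ), ∀ θ₀ : Param d, ‖θ₀ - θs‖ ≤ u ^ 50 → ∃ bad : Set Ω,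
        P bad ≤ ENNReal.ofReal (Real.exp (-(u⁻¹) ^ 3)) ∧ ∀ ω ∉ bad, ∀ t : ℕ, t * u ^ 160 ≤ 1 →
        ‖iterate f x y (u ^ 100) θ₀ (fun s => idx s ω) (fun s => ξ s ω) t - θs‖ ≤ u ^ 39 ∧
        ∀ j, |inner ℝ (e j) (iterate f x y (u ^ 100) θ₀ (fun s => idx s ω) (fun s => ξ s ω) t - θs) +
          t * (u ^ 200 * w j)| ≤ 2 * u ^ 46 := by
  have hn := hS.ne_zero
  obtain ⟨B, -, hB⟩ := hS.exists_bound
  obtain ⟨e, l, γ, c, hcorr⟩ := exists_correctors hn hf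
  obtain ⟨C, r, hC, hr, hd, hGm, hDm, hexp⟩ := exists_expansion hf hzero (max c B)
  have hc := hcorr C ((le_max_left _ _).trans hC)
  have hBC : ∀ᵐ ω ∂P, ∀ t, |ξ t ω| ≤ C :=
    hB.mono fun ω h t => (h t).trans ((le_max_right _ _).trans hC)
  -- These are the coordinates of the projection of the regularizer's gradient onto the flat
  -- directions, which are spanned by the `e j` with `l j = 0`.
  refine ⟨e, fun j => if l j = 0 then inner ℝ (∇ (reg f x) θs) (e j) else 0, fun j => ?_,
    ⟨fun hstat => ?_, fun hw v hv => ?_⟩, ?_⟩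
  · by_cases hj : l j = 0
    · exact Or.inr (if_pos hj)
    · exact Or.inl (if_neg hj)
  · ext j
    by_cases hj : l j = 0
    · rw [if_pos hj]
      refine hstat _ (mem_flatDirections.2 fun i => ?_)
      refine eq_zero_of_avg_sq_eq_zero hn
        (u := fun i => inner ℝ (∇ (fun ϑ => f ϑ (x i)) θs) (e j)) ?_ i
      have h1 := hc.eigen j (e j)
      rw [hj, zero_mul] at h1
      rw [← h1]; congr 1; ext i
      rw [real_inner_comm (∇ (fun ϑ => f ϑ (x i)) θs) (e j), sq]
    · exact if_neg hj
  · rw [← e.sum_inner_mul_inner]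
    refine Finset.sum_eq_zero fun j _ => ?_
    by_cases hj : l j = 0
    · have h1 := congrFun hw j
      simp only [if_pos hj, Pi.zero_apply] at h1
      rw [h1, zero_mul]
    · have h1 := hc.eigen j v
      simp only [mem_flatDirections.1 hv, zero_mul] at h1
      have h2 : l j * inner ℝ (e j) v = 0 := by rw [← h1, avg_const hn]
      rw [(mul_eq_zero.1 h2).resolve_left hj, mul_zero]
  · filter_upwards [hexp.exists_bad_event hr hc hGm hDm hS hBC, eventually_small r⁻¹]
      with u hu ⟨hu0, hu1, hur⟩ θ₀ hθ₀
    obtain ⟨bad, hbad, hgood⟩ := hu (θ₀ - θs) hθ₀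
    refine ⟨bad, hbad, fun ω hω t ht => ?_⟩
    have hle : u ^ 39 ≤ r := by
      have h1 : u ≤ r := by rwa [inv_mul_le_iff₀ hr, mul_one] at hur
      exact (pow_le_of_le_one hu0.le hu1 (by norm_num)).trans h1
    rw [iterate_eq_add_sgdPath hd (u ^ 100) θ₀ idx ξ ω t fun s hs => ?_, add_sub_cancel_left]
    · exact hgood ω hω t ht
    · refine ((hgood ω hω s (le_trans ?_ ht)).1).trans hle
      gcongr

end model

/-! ### Return to powers of `η` and the two cases. -/

section scale
variable {u : ℝ}

theorem pow_hundred_rpow (hu : 0 < u) (k : ℕ) {s : ℝ} (hs : 100 * s = k) :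
    (u ^ 100) ^ s = u ^ k := by
  rw [← Real.rpow_natCast u 100, ← Real.rpow_mul hu.le, ← Real.rpow_natCast u k]
  congr 1

theorem pow_hundred_rpow_neg (hu : 0 < u) (k : ℕ) {s : ℝ} (hs : 100 * s = k) :
    (u ^ 100) ^ (-s) = (u⁻¹) ^ k := by
  rw [Real.rpow_neg (by positivity), pow_hundred_rpow hu k hs, inv_pow]

/-- A property of small learning rates may be checked for learning rates `u ^ 100`. -/
theorem eventually_of_pow_hundred {p : ℝ → Prop} (h : ∀ᶠ u in 𝓝[>] (0 : ℝ), p (u ^ 100)) :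
    ∀ᶠ η in 𝓝[>] (0 : ℝ), p η := by
  have h1 : Tendsto (fun η : ℝ => η ^ (0.01 : ℝ)) (𝓝[>] 0) (𝓝[>] 0) := by
    refine tendsto_nhdsWithin_iff.2 ⟨?_, ?_⟩
    · have h2 := (Real.continuousAt_rpow_const 0 (0.01 : ℝ) (Or.inr (by norm_num))).tendsto
      rw [Real.zero_rpow (by norm_num)] at h2
      exact h2.mono_left nhdsWithin_le_nhds
    · filter_upwards [self_mem_nhdsWithin] with η hη using Real.rpow_pos_of_pos hη _
  filter_upwards [h1.eventually h, self_mem_nhdsWithin] with η hη hη0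
  have h2 : (η ^ (0.01 : ℝ)) ^ 100 = η := by
    rw [← Real.rpow_natCast, ← Real.rpow_mul (le_of_lt hη0)]
    norm_num
  rwa [h2] at hη

end scale

variable {d n : ℕ} {X : Type*} {f : Param d → X → ℝ} {x : Fin n → X} {y : Fin n → ℝ}
  {θs : Param d} {Ω : Type*} [MeasurableSpace Ω] {P : Measure Ω} [IsProbabilityMeasure P]
  {idx : ℕ → Ω → Fin n} {ξ : ℕ → Ω → ℝ}

/-- Without drift every coordinate is at most `2 * u ^ 46`, and the gap between `0.46` and `0.44`
absorbs the factor `2 * d`. The failure bound `exp (-u ^ (-3))` gives `κ = 0.03`. -/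
theorem nonRepellent_of_regStationary (hS : IsSampling P idx ξ)
    (hf : ∀ i, ContDiffAt ℝ 3 (fun θ => f θ (x i)) θs) (hzero : ∀ i, f θs (x i) = y i)
    (hstat : RegStationary f x θs) : NonRepellent f x y P idx ξ θs := by
  obtain ⟨e, w, -, hiff, hev⟩ := exists_drift hS hf hzero
  have hw : w = 0 := hiff.1 hstat
  refine ⟨0.03, by norm_num, eventually_of_pow_hundred ?_⟩
  filter_upwards [hev, eventually_small (2 * d)] with u hu ⟨hu0, hu1, hud⟩ θ₀ hθ₀
  rw [pow_hundred_rpow hu0 50 (s := 0.5) (by norm_num)] at hθ₀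
  obtain ⟨bad, hbad, hgood⟩ := hu θ₀ hθ₀
  rw [pow_hundred_rpow_neg hu0 3 (s := 0.03) (by norm_num)]
  refine (measure_mono ?_).trans hbad
  rw [Set.compl_subset_comm]
  intro ω hω t ht
  rw [pow_hundred_rpow_neg hu0 160 (s := 1.6) (by norm_num), inv_pow, ← one_div,
    le_div_iff₀ (by positivity)] at ht
  rw [pow_hundred_rpow hu0 44 (s := 0.44) (by norm_num)]
  have h1 := (hgood ω hω t ht).2
  simp only [hw, Pi.zero_apply, mul_zero, add_zero] at h1
  calc _ ≤ d * (2 * u ^ 46) := norm_le_of_abs_inner_le e h1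
    _ = (2 * d * u) * (u * u ^ 44) := by ring
    _ ≤ 1 * (1 * u ^ 44) := by gcongr
    _ = _ := by ring

/-- To first order the decrease is `-⟨g, p⟩`, and `p` has coordinates `-τ * w j` up to `2 * u ^ 46`.
Since `w j` is either `0` or the coordinate of `g`, this gives `τ * ∑ j, w j ^ 2`. The starting
offset and the quadratic remainders are also at most of order `u ^ 46`. -/
theorem abs_reg_sub_le {e : OrthonormalBasis (Fin d) ℝ (Param d)} {w : Fin d → ℝ} {g p p₀ : Param d}
    (hw : ∀ j, w j = 0 ∨ w j = inner ℝ g (e j)) {C u τ ρ₀ ρ₁ ρs : ℝ} (hC : 0 ≤ C) (hu : 0 < u)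
    (hu1 : u ≤ 1) (hp₀ : ‖p₀‖ ≤ u ^ 50) (hp : ‖p‖ ≤ u ^ 39)
    (hτ : |τ - u ^ 40| ≤ u ^ 200)
    (hdrift : ∀ j, |inner ℝ (e j) p + τ * w j| ≤ 2 * u ^ 46)
    (hρ₀ : |ρ₀ - ρs - inner ℝ g p₀| ≤ C * ‖p₀‖ ^ 2) (hρ₁ : |ρ₁ - ρs - inner ℝ g p| ≤ C * ‖p‖ ^ 2) :
    |ρ₀ - ρ₁ - (∑ j, w j ^ 2) * u ^ 40| ≤
      (‖g‖ + 2 * C + 2 * ∑ j, |inner ℝ g (e j)| + ∑ j, w j ^ 2) * u ^ 46 := by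
  have hww : ∀ j, inner ℝ g (e j) * w j = w j ^ 2 := fun j => by
    rcases hw j with h | h
    · rw [h]; ring
    · rw [← h]; ring
  have hsum0 : 0 ≤ ∑ j, w j ^ 2 := Finset.sum_nonneg fun j _ => sq_nonneg _
  have hgp : inner ℝ g p + (∑ j, w j ^ 2) * τ =
      ∑ j, inner ℝ g (e j) * (inner ℝ (e j) p + τ * w j) := by
    rw [← e.sum_inner_mul_inner g p, Finset.sum_mul, ← Finset.sum_add_distrib]
    refine Finset.sum_congr rfl fun j _ => ?_
    rw [← hww j]; ring
  have h1 : |inner ℝ g p + (∑ j, w j ^ 2) * τ| ≤ 2 * (∑ j, |inner ℝ g (e j)|) * u ^ 46 := by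
    rw [hgp, mul_comm 2, mul_assoc, Finset.sum_mul]
    refine (Finset.abs_sum_le_sum_abs _ _).trans (Finset.sum_le_sum fun j _ => ?_)
    rw [abs_mul]
    exact mul_le_mul_of_nonneg_left (hdrift j) (abs_nonneg _)
  have h2 : |(∑ j, w j ^ 2) * (τ - u ^ 40)| ≤ (∑ j, w j ^ 2) * u ^ 46 := by
    rw [abs_mul, abs_of_nonneg hsum0]
    exact mul_le_mul_of_nonneg_left
      (hτ.trans (pow_le_pow_of_le_one hu.le hu1 (by norm_num))) hsum0
  have h3 : |inner ℝ g p₀| ≤ ‖g‖ * u ^ 46 := by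
    refine (abs_real_inner_le_norm _ _).trans ?_
    exact mul_le_mul_of_nonneg_left
      (hp₀.trans (pow_le_pow_of_le_one hu.le hu1 (by norm_num))) (norm_nonneg g)
  have h4 : C * ‖p₀‖ ^ 2 ≤ C * u ^ 46 := by
    refine mul_le_mul_of_nonneg_left ((pow_le_pow_left₀ (norm_nonneg _) hp₀ 2).trans ?_) hC
    rw [← pow_mul]
    exact pow_le_pow_of_le_one hu.le hu1 (by norm_num)
  have h5 : C * ‖p‖ ^ 2 ≤ C * u ^ 46 := by
    refine mul_le_mul_of_nonneg_left ((pow_le_pow_left₀ (norm_nonneg _) hp 2).trans ?_) hC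
    rw [← pow_mul]
    exact pow_le_pow_of_le_one hu.le hu1 (by norm_num)
  have h6 := hρ₀.trans h4
  have h7 := hρ₁.trans h5
  rw [abs_le] at h1 h2 h3 h6 h7 ⊢
  constructor <;> linarith [h1.1, h1.2, h2.1, h2.2, h3.1, h3.2, h6.1, h6.2, h7.1, h7.2]

theorem stronglyRepellent_of_not_regStationary (hS : IsSampling P idx ξ)
    (hf : ∀ i, ContDiffAt ℝ 3 (fun θ => f θ (x i)) θs) (hzero : ∀ i, f θs (x i) = y i)
    (hstat : ¬ RegStationary f x θs) : StronglyRepellent f x y P idx ξ θs := by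
  obtain ⟨e, w, hw, hiff, hev⟩ := exists_drift hS hf hzero
  obtain ⟨j, hj⟩ : ∃ j, w j ≠ 0 := by
    by_contra hcon
    push Not at hcon
    exact hstat (hiff.2 (funext hcon))
  obtain ⟨C, hC, hreg⟩ := exists_norm_sub_fderiv_le (contDiffAt_reg hf)
  obtain ⟨r, hr, hball⟩ := Metric.eventually_nhds_iff_ball.1 hreg
  have hreg' : ∀ θ, ‖θ - θs‖ < r → |reg f x θ - reg f x θs - inner ℝ (∇ (reg f x) θs) (θ - θs)| ≤
      C * ‖θ - θs‖ ^ 2 := fun θ hθ => by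
    rw [inner_gradient_left]
    exact hball θ (by rwa [mem_ball_iff_norm])
  have hwj : 0 < |w j| := abs_pos.2 hj
  set g := ∇ (reg f x) θs with hg
  let K := ‖g‖ + 2 * C + 2 * ∑ j, |inner ℝ g (e j)| + ∑ j, w j ^ 2
  have hc₂ : 0 < ∑ j, w j ^ 2 :=
    Finset.sum_pos' (fun j _ => sq_nonneg _) ⟨j, Finset.mem_univ j, by positivity⟩
  -- One nonzero drift coordinate suffices for the distance, with half of it left for errors; `c₂`
  -- is the squared norm of the whole drift vector.
  refine ⟨|w j| / 2, ∑ j, w j ^ 2, 0.03, half_pos hwj, hc₂, by norm_num,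
    fun η => K * η ^ (0.46 : ℝ), ?_, eventually_of_pow_hundred ?_⟩
  · refine IsLittleO.const_mul_left ?_ K
    have h1 : Tendsto (fun η : ℝ => η ^ (0.06 : ℝ)) (𝓝[>] 0) (𝓝 0) := by
      have h2 := (Real.continuousAt_rpow_const 0 (0.06 : ℝ) (Or.inr (by norm_num))).tendsto
      rw [Real.zero_rpow (by norm_num)] at h2
      exact h2.mono_left nhdsWithin_le_nhds
    have h3 := ((isLittleO_one_iff ℝ).2 h1).mul_isBigO
      (isBigO_refl (fun η : ℝ => η ^ (0.4 : ℝ)) (𝓝[>] 0))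
    refine h3.congr' ?_ ?_
    · filter_upwards [self_mem_nhdsWithin] with η hη
      rw [← Real.rpow_add hη]; norm_num
    · exact Eventually.of_forall fun η => one_mul _
  · filter_upwards [hev, eventually_small (2 * r⁻¹), eventually_small ((|w j| / 2)⁻¹ * (|w j| + 2))]
      with u hu ⟨hu0, hu1, hur⟩ ⟨_, _, huw⟩ θ₀ hθ₀
    have hur' : u < r := by
      rw [mul_comm 2, mul_assoc, inv_mul_le_iff₀ hr, mul_one] at hur
      linarith
    rw [mul_assoc, inv_mul_le_iff₀ (half_pos hwj), mul_one] at huw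
    rw [pow_hundred_rpow hu0 50 (s := 0.5) (by norm_num)] at hθ₀
    obtain ⟨bad, hbad, hgood⟩ := hu θ₀ hθ₀
    rw [pow_hundred_rpow_neg hu0 3 (s := 0.03) (by norm_num), pow_hundred_rpow hu0 40 (s := 0.4) (by norm_num),
      pow_hundred_rpow_neg hu0 160 (s := 1.6) (by norm_num), pow_hundred_rpow hu0 46 (s := 0.46) (by norm_num)]
    refine (measure_mono ?_).trans hbad
    rw [Set.compl_subset_comm]
    intro ω hω
    obtain ⟨T, hT⟩ : ∃ T : ℕ, T = ⌊(u⁻¹) ^ 160⌋₊ := ⟨_, rfl⟩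
    have hTle : T * u ^ 160 ≤ 1 := by
      rw [← le_div_iff₀ (by positivity), one_div, ← inv_pow, hT]
      exact Nat.floor_le (by positivity)
    have hTge : 1 ≤ (T + 1) * u ^ 160 := by
      rw [← div_le_iff₀ (by positivity), one_div, ← inv_pow, hT]
      exact (Nat.lt_floor_add_one _).le
    -- Rounding the time down changes `T * η²` from `η^0.4` by at most `η²`.
    have hτ : |T * u ^ 200 - u ^ 40| ≤ u ^ 200 := by
      have hu40 : 0 < u ^ 40 := by positivity
      have h1 : T * u ^ 200 = (T * u ^ 160) * u ^ 40 := by ring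
      have h2 : ((T + 1) * u ^ 160) * u ^ 40 = T * u ^ 200 + u ^ 200 := by ring
      have h3 := mul_le_mul_of_nonneg_right hTle hu40.le
      have h4 := mul_le_mul_of_nonneg_right hTge hu40.le
      have h5 : 0 < u ^ 200 := by positivity
      rw [abs_le]
      constructor <;> linarith
    obtain ⟨hnorm, hdrift⟩ := hgood ω hω T hTle
    simp only [Set.mem_ofPred_eq, ← hT]
    have hpow : ∀ {k : ℕ}, k ≠ 0 → u ^ k < r := fun hk =>
      (pow_le_of_le_one hu0.le hu1 hk).trans_lt hur'
    have hdrift' : ∀ j, |inner ℝ (e j) (iterate f x y (u ^ 100) θ₀ (fun s => idx s ω)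
        (fun s => ξ s ω) T - θs) + (T * u ^ 200) * w j| ≤ 2 * u ^ 46 := fun j => by
      rw [mul_assoc]; exact hdrift j
    refine ⟨?_, abs_reg_sub_le hw hC hu0 hu1 hθ₀ hnorm hτ hdrift'
      (hreg' θ₀ (hθ₀.trans_lt (hpow (by norm_num)))) (hreg' _ (hnorm.trans_lt (hpow (by norm_num))))⟩
    have h1 := abs_real_inner_le_norm (e j) (iterate f x y (u ^ 100) θ₀ (fun s => idx s ω)
        (fun s => ξ s ω) T - θs)
    rw [e.norm_eq_one, one_mul] at h1
    refine le_trans ?_ h1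
    have h2 : |w j| * u ^ 40 - |w j| * u ^ 200 ≤ |(T * u ^ 200) * w j| := by
      rw [abs_mul, mul_comm _ |w j|, ← mul_sub]
      refine mul_le_mul_of_nonneg_left ?_ hwj.le
      have := (abs_le.1 hτ).1
      have := le_abs_self (T * u ^ 200)
      linarith
    have h3 := abs_sub (inner ℝ (e j) (iterate f x y (u ^ 100) θ₀ (fun s => idx s ω)
        (fun s => ξ s ω) T - θs) + (T * u ^ 200) * w j) (inner ℝ (e j) (iterate f x y (u ^ 100) θ₀
          (fun s => idx s ω) (fun s => ξ s ω) T - θs))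
    rw [add_sub_cancel_left] at h3
    -- The rounding error and the coordinate error together use at most half of the drift `|w j| * u
    -- ^ 40`.
    have h4 : |w j| * u ^ 200 + 2 * u ^ 46 ≤ |w j| / 2 * u ^ 40 := by
      have h5 : u ^ 200 ≤ u * u ^ 40 := by
        rw [← pow_succ']; exact pow_le_pow_of_le_one hu0.le hu1 (by norm_num)
      have h6 : u ^ 46 ≤ u * u ^ 40 := by
        rw [← pow_succ']; exact pow_le_pow_of_le_one hu0.le hu1 (by norm_num)
      calc _ ≤ |w j| * (u * u ^ 40) + 2 * (u * u ^ 40) := by gcongr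
        _ = ((|w j| + 2) * u) * u ^ 40 := by ring
        _ ≤ _ := by gcongr
    linarith [hdrift' j]

end LabelNoiseSGD

theorem mainTheorem1 {d n : ℕ} {X Ω : Type*} [MeasurableSpace Ω]
    (P : Measure Ω) [IsProbabilityMeasure P]
    (f : LabelNoiseSGD.Param d → X → ℝ) (x : Fin n → X) (y : Fin n → ℝ)
    (idx : ℕ → Ω → Fin n) (ξ : ℕ → Ω → ℝ) (hS : LabelNoiseSGD.IsSampling P idx ξ)
    (θs : LabelNoiseSGD.Param d)
    (hf : ∀ i, ContDiffAt ℝ 3 (fun θ => f θ (x i)) θs)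
    (hzero : ∀ i, f θs (x i) = y i) :
    (LabelNoiseSGD.RegStationary f x θs →
      LabelNoiseSGD.NonRepellent f x y P idx ξ θs) ∧
    (¬ LabelNoiseSGD.RegStationary f x θs →
      LabelNoiseSGD.StronglyRepellent f x y P idx ξ θs) := by
  exact ⟨LabelNoiseSGD.nonRepellent_of_regStationary hS hf hzero,
    LabelNoiseSGD.stronglyRepellent_of_not_regStationary hS hf hzero⟩
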